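/- **Setting.** For $N\ge 1$ let $\Gamma(N)\subset SL_2(\mathbb Z)$ be the principal congruence subgroup of level $N$. All vector spaces and algebras are over $\mathbb C$. For $k\ge 0$ let $\mathcal M_k$ be the space of functions on the upper half plane $\mathbb H$ that are modular forms of weight $k$ for some $\Gamma(N)$, $N\ge 1$, and let $\mathcal M=\bigoplus_{k\ge 0}\mathcal M_k$. A holomorphic function $f$ on $\mathbb H$ is *quasimodular* of level $N$, weight $k$ and depth at most $s$ if there are holomorphic functions $f_0,\dots,f_s$ on $\mathbb H$ such that $$(cz+d)^{-k}f\Big(\frac{az+b}{cz+d}\Big)=\sum_{j=0}^s f_j(z)\Big(\frac{c}{cz+d}\Big)^j\qquad \forall z\in\mathbb H,\ \begin{pmatrix}a&b\\c&d\end{pmatrix}\in\Gamma(N),$$ and each $f_j$ is holomorphic at all cusps, i.e. for every $\begin{pmatrix}a&b\\c&d\end{pmatrix}\in SL_2(\mathbb Z)$ the function $(cz+d)^{-(k-2j)}f_j\big(\frac{az+b}{cz+d}\big)$ is bounded as $\mathrm{Im}\,z\to\infty$. Let $\mathcal{QM}_k$ be the space of functions that are quasimodular of weight $k$ for some level $N\ge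 1$ and some depth, and $\mathcal{QM}=\bigoplus_{k\ge0}\mathcal{QM}_k$; both $\mathcal M$ and $\mathcal{QM}$ are graded commutative algebras under multiplication of functions. Let $$G_2(z)=-\frac{B_2}{4}+\sum_{n\ge1}\Big(\sum_{d\mid n}d\Big)e^{2\pi i n z}\in\mathcal{QM}_2 .$$ By the structure theorem for quasimodular forms every $f\in\mathcal{QM}$ can be written uniquely as a finite sum $f=\sum_i a_i(f)G_2^i$ with $a_i(f)\in\mathcal M$. For $\alpha=\begin{pmatrix}a&b\\c&d\end{pmatrix}\in GL_2^+(\mathbb Q)$ and $f\in\mathcal M_k$ put $(f|\alpha)(z)=(cz+d)^{-k}f\big(\frac{az+b}{cz+d}\big)$; extend $|\alpha$ linearly to $\mathcal M$ and put $f\|\alpha=\sum_i (a_i(f)|\alpha)\,G_2^i$ for $f\in\mathcal{QM}$. On $\mathcal M$ let $Y:\mathcal M_k\to\mathcal M_k$ and $X:\mathcal M_k\to\mathcal M_{k+2}$ be $$Y(f)=\frac k2 f,\qquad X(f)=\frac1{2\pi i}\frac{d}{dz}f-\frac1{12\pi i}\frac{d}{dz}(\log\Delta)\cdot Y(f),\qquad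 \Delta(z)=(2\pi)^{12}q\prod_{n\ge1}(1-q^n)^{24},\ q=e^{2\pi iz},$$ and extend them to $\mathcal{QM}$ by $X(f)=\sum_iX(a_i(f))G_2^i$, $Y(f)=\sum_iY(a_i(f))G_2^i$. Let $\sigma\in SL_2(\mathbb Z)$ and $\Gamma=\Gamma(N)$, $N\geq 1$. Let $\mathcal Q_\sigma(\Gamma)$ be the vector space of functions of finite support $$F:\Gamma\backslash GL_2^+(\mathbb Q)\to\mathcal{QM},\quad \Gamma\alpha\mapsto F_\alpha,\qquad\text{with } F_{\alpha\gamma}=F_\alpha\|\sigma\gamma\sigma^{-1}\quad\forall\gamma\in\Gamma .$$ Let $\mathfrak l_1$ be the complex Lie algebra with basis $X,Y$ and $[Y,X]=X$, let $\mathfrak h_1=U(\mathfrak l_1)$ be its universal enveloping algebra, and let $\Delta:\mathfrak h_1\to\mathfrak h_1\otimes\mathfrak h_1$, $\Delta(h)=\sum h_{(1)}\otimes h_{(2)}$, be its coproduct, the algebra homomorphism with $\Delta(u)=u\otimes1+1\otimes u$ for $u\in\mathfrak l_1$. **Statement.** The formula $$(F^1,F^2)_\alpha=\sum_{\beta\in\Gamma\backslash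 SL_2(\mathbb Z)}F^1_{\beta\sigma}\cdot\big(F^2_{\alpha\sigma^{-1}\beta^{-1}}\|\sigma\beta\big)$$ does not depend on the choice of coset representatives and defines a bilinear pairing $\mathcal Q_\sigma(\Gamma)\times\mathcal Q_\sigma(\Gamma)\to\mathcal Q_\sigma(\Gamma)$, and the following hold. (a) The formulas $$X(F)_\alpha=X(F_\alpha),\qquad Y(F)_\alpha=Y(F_\alpha)\qquad\forall F\in\mathcal Q_\sigma(\Gamma),\ \alpha\in GL_2^+(\mathbb Q)$$ define a Lie action of $\mathfrak l_1$ on $\mathcal Q_\sigma(\Gamma)$. (b) For the induced action of $\mathfrak h_1$ on $\mathcal Q_\sigma(\Gamma)$ one has $$h(F^1,F^2)=\sum\big(h_{(1)}(F^1),h_{(2)}(F^2)\big)\qquad\forall h\in\mathfrak h_1,\ F^1,F^2\in\mathcal Q_\sigma(\Gamma).$$ -/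

import Mathlib

open UpperHalfPlane hiding I
open Complex hiding Gamma
open CongruenceSubgroup Matrix.SpecialLinearGroup
open scoped MatrixGroups ModularForm Manifold DirectSum TensorProduct

attribute [local instance 100] LieRing.ofAssociativeRing

noncomputable section

namespace QMHecke

/-! ### The modular tower -/

lemma Gamma_le_of_dvd {N M : ℕ} (h : N ∣ M) : Gamma M ≤ Gamma N := by
  intro γ hγ
  rw [Gamma_mem] at hγ ⊢
  obtain ⟨h1, h2, h3, h4⟩ := hγ
  have key : ∀ a b : ℤ, (a : ZMod M) = (b : ZMod M) → (a : ZMod N) = (b : ZMod N) := by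
    intro a b hab
    rw [ZMod.intCast_eq_intCast_iff_dvd_sub] at hab ⊢
    exact (Int.natCast_dvd_natCast.mpr h).trans hab
  refine ⟨?_, ?_, ?_, ?_⟩
  · simpa using key _ 1 (by simpa using h1)
  · simpa using key _ 0 (by simpa using h2)
  · simpa using key _ 0 (by simpa using h3)
  · simpa using key _ 1 (by simpa using h4)

/-- Unbundled description of modular forms of weight `k` for `Γ(N)`. -/
def IsModular (N : ℕ) (k : ℤ) (f : ℍ → ℂ) : Prop :=
  (∀ γ ∈ Gamma N, f ∣[k] γ = f) ∧ MDiff f ∧ ∀ γ : SL(2, ℤ), IsBoundedAtImInfty (f ∣[k] γ)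

lemma exists_modularForm_iff {N : ℕ} (hN : N ≠ 0) {k : ℤ} {f : ℍ → ℂ} :
    (∃ g : ModularForm ((Gamma N).map (mapGL ℝ)) k, ⇑g = f) ↔ IsModular N k f := by
  have : NeZero N := ⟨hN⟩
  have hcusp : ∀ c : OnePoint ℝ,
      IsCusp c ((Gamma N).map (mapGL ℝ)) ↔ IsCusp c 𝒮ℒ := fun c =>
    Subgroup.IsArithmetic.isCusp_iff_isCusp_SL2Z _
  constructor
  · rintro ⟨g, rfl⟩
    refine ⟨fun γ hγ => ?_, g.holo', fun γ => ?_⟩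
    · exact SlashInvariantFormClass.slash_action_eq g _ ⟨γ, hγ, rfl⟩
    · have hc : IsCusp (mapGL ℝ γ • OnePoint.infty) 𝒮ℒ := isCusp_SL2Z_iff'.mpr ⟨γ, rfl⟩
      exact (OnePoint.isBoundedAt_iff_forall_SL2Z hc).mp
        (g.bdd_at_cusps' ((hcusp _).mpr hc)) γ rfl
  · rintro ⟨h1, h2, h3⟩
    refine ⟨⟨⟨f, ?_⟩, h2, ?_⟩, rfl⟩
    · rintro _ ⟨γ, hγ, rfl⟩
      exact h1 γ hγ
    · intro c hc
      exact (OnePoint.isBoundedAt_iff_forall_SL2Z ((hcusp _).mp hc)).mpr fun γ _ => h3 γ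

lemma IsModular.mono {N M : ℕ} (h : N ∣ M) {k : ℤ} {f : ℍ → ℂ} (hf : IsModular N k f) :
    IsModular M k f :=
  ⟨fun γ hγ => hf.1 γ (Gamma_le_of_dvd h hγ), hf.2⟩

lemma IsModular.mul {N : ℕ} {k l : ℤ} {f g : ℍ → ℂ} (hf : IsModular N k f)
    (hg : IsModular N l g) : IsModular N (k + l) (f * g) := by
  refine ⟨fun γ hγ => ?_, hf.2.1.mul hg.2.1, fun γ => ?_⟩
  · rw [ModularForm.mul_slash_SL2, hf.1 γ hγ, hg.1 γ hγ]
  · rw [ModularForm.mul_slash_SL2]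
    exact (hf.2.2 γ).mul (hg.2.2 γ)

/-- `M_k`: functions on `ℍ` which are modular forms of weight `k` for some `Γ(N)`, `N ≥ 1`. -/
def modTower (k : ℕ) : Submodule ℂ (ℍ → ℂ) where
  carrier := {f | ∃ N : ℕ, N ≠ 0 ∧
    ∃ g : ModularForm ((Gamma N).map (mapGL ℝ)) (k : ℤ), ⇑g = f}
  zero_mem' := ⟨1, one_ne_zero, 0, rfl⟩
  add_mem' := by
    rintro f g ⟨N, hN, hf⟩ ⟨M, hM, hg⟩
    rw [exists_modularForm_iff hN] at hf
    rw [exists_modularForm_iff hM] at hg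
    refine ⟨N * M, mul_ne_zero hN hM, (exists_modularForm_iff (mul_ne_zero hN hM)).mpr ?_⟩
    have hf' := hf.mono (Dvd.intro M rfl)
    have hg' := hg.mono (Dvd.intro_left N rfl)
    refine ⟨fun γ hγ => ?_, hf.2.1.add hg.2.1, fun γ => ?_⟩
    · rw [SlashAction.add_slash, hf'.1 γ hγ, hg'.1 γ hγ]
    · rw [SlashAction.add_slash]
      exact (hf'.2.2 γ).add (hg'.2.2 γ)
  smul_mem' := by
    rintro c f ⟨N, hN, hf⟩
    rw [exists_modularForm_iff hN] at hf
    refine ⟨N, hN, (exists_modularForm_iff hN).mpr ⟨fun γ hγ => ?_, hf.2.1.const_smul c,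
      fun γ => ?_⟩⟩
    · rw [ModularForm.SL_smul_slash, hf.1 γ hγ]
    · rw [ModularForm.SL_smul_slash]
      exact (hf.2.2 γ).const_smul_left c

lemma mem_modTower {k : ℕ} {f : ℍ → ℂ} :
    f ∈ modTower k ↔ ∃ N : ℕ, N ≠ 0 ∧ IsModular N k f :=
  exists_congr fun _ => and_congr_right fun hN => exists_modularForm_iff hN

lemma isModular_one : IsModular 1 0 1 :=
  ⟨fun γ _ => ModularForm.is_invariant_one γ, mdifferentiable_const, fun γ => by
    rw [ModularForm.is_invariant_one]
    exact Filter.const_boundedAtFilter _ 1⟩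

instance : SetLike.GradedMonoid modTower where
  one_mem := mem_modTower.mpr ⟨1, one_ne_zero, isModular_one⟩
  mul_mem := by
    intro i j f g hf hg
    obtain ⟨N, hN, hf⟩ := mem_modTower.mp hf
    obtain ⟨M, hM, hg⟩ := mem_modTower.mp hg
    refine mem_modTower.mpr ⟨N * M, mul_ne_zero hN hM, ?_⟩
    push_cast
    exact (hf.mono (Dvd.intro M rfl)).mul (hg.mono (Dvd.intro_left N rfl))

/-- The modular tower `M = ⨁ₖ Mₖ`, a graded commutative `ℂ`-algebra. -/
def ModTower : Type := ⨁ k : ℕ, modTower k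

instance : CommRing ModTower := inferInstanceAs (CommRing (⨁ k : ℕ, modTower k))

instance : Algebra ℂ ModTower := inferInstanceAs (Algebra ℂ (⨁ k : ℕ, modTower k))

/-- The inclusion `Mₖ → M` of the component of weight `k`. -/
def ofM (k : ℕ) : modTower k →ₗ[ℂ] ModTower := DirectSum.lof ℂ ℕ (fun k => modTower k) k

/-! ### The quasimodular tower -/

/-- `f` is quasimodular of level `N`, weight `k` and depth at most `s`: there are holomorphic
`F 0, …, F s` with `(f|ₖγ)(z) = ∑ⱼ Fⱼ(z) (c/(cz+d))ʲ` for all `γ ∈ Γ(N)`, holomorphic at the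
cusps, i.e. `Fⱼ|_{k-2j} γ` is bounded at `i∞` for every `γ ∈ SL₂(ℤ)`.
Exact depth `s` means in addition `F s ≠ 0`; dropping vanishing top terms shows that "some exact
depth, or zero" is the same as "depth at most `s` for some `s`". -/
def IsQuasimodular (N k s : ℕ) (f : ℍ → ℂ) : Prop :=
  MDiff f ∧ ∃ F : ℕ → ℍ → ℂ,
    (∀ j ≤ s, MDiff (F j)) ∧
    (∀ j ≤ s, ∀ γ : SL(2, ℤ), IsBoundedAtImInfty (F j ∣[(k : ℤ) - 2 * j] γ)) ∧
    ∀ γ ∈ Gamma N, ∀ z : ℍ, (f ∣[(k : ℤ)] γ) z =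
      ∑ j ∈ Finset.range (s + 1), F j z * ((γ 1 0 : ℂ) / denom γ z) ^ j

/-- The same data with the coefficients extended by zero. -/
lemma IsQuasimodular.exists_ext {N k s : ℕ} {f : ℍ → ℂ} (hf : IsQuasimodular N k s f) :
    ∃ F : ℕ → ℍ → ℂ, (∀ j, MDiff (F j)) ∧
      (∀ j : ℕ, ∀ γ : SL(2, ℤ), IsBoundedAtImInfty (F j ∣[(k : ℤ) - 2 * j] γ)) ∧
      (∀ j, s < j → F j = 0) ∧
      ∀ t, s ≤ t → ∀ γ ∈ Gamma N, ∀ z : ℍ, (f ∣[(k : ℤ)] γ) z =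
        ∑ j ∈ Finset.range (t + 1), F j z * ((γ 1 0 : ℂ) / denom γ z) ^ j := by
  obtain ⟨_, F, h1, h2, h3⟩ := hf
  refine ⟨fun j => if j ≤ s then F j else 0, fun j => ?_, fun j γ => ?_, fun j hj => ?_,
    fun t ht γ hγ z => ?_⟩
  · dsimp only
    split_ifs with h
    · exact h1 j h
    · exact mdifferentiable_const
  · dsimp only
    split_ifs with h
    · exact h2 j h γ
    · rw [SlashAction.zero_slash]
      exact Filter.const_boundedAtFilter _ 0
  · simp [Nat.not_le.mpr hj]
  · rw [h3 γ hγ z]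
    have hsub : Finset.range (s + 1) ⊆ Finset.range (t + 1) :=
      Finset.range_subset_range.mpr (by lia)
    rw [← Finset.sum_subset hsub]
    · refine Finset.sum_congr rfl fun j hj => ?_
      dsimp only
      rw [if_pos (by simpa [Nat.lt_succ_iff] using hj)]
    · intro j _ hj
      dsimp only
      rw [if_neg (by simpa [Nat.lt_succ_iff] using hj)]
      simp

lemma IsQuasimodular.add {N M k s t : ℕ} {f g : ℍ → ℂ} (hf : IsQuasimodular N k s f)
    (hg : IsQuasimodular M k t g) : IsQuasimodular (N * M) k (max s t) (f + g) := by
  obtain ⟨F, hF1, hF2, -, hF⟩ := hf.exists_ext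
  obtain ⟨G, hG1, hG2, -, hG⟩ := hg.exists_ext
  refine ⟨hf.1.add hg.1, fun j => F j + G j, fun j _ => (hF1 j).add (hG1 j), fun j _ γ => ?_,
    fun γ hγ z => ?_⟩
  · rw [SlashAction.add_slash]
    exact (hF2 j γ).add (hG2 j γ)
  · rw [SlashAction.add_slash, Pi.add_apply,
      hF _ (le_max_left s t) γ (Gamma_le_of_dvd (Dvd.intro M rfl) hγ) z,
      hG _ (le_max_right s t) γ (Gamma_le_of_dvd (Dvd.intro_left N rfl) hγ) z,
      ← Finset.sum_add_distrib]
    exact Finset.sum_congr rfl fun j _ => by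
      dsimp only
      rw [Pi.add_apply, add_mul]

lemma IsQuasimodular.smul {N k s : ℕ} {f : ℍ → ℂ} (hf : IsQuasimodular N k s f) (c : ℂ) :
    IsQuasimodular N k s (c • f) := by
  obtain ⟨h0, F, h1, h2, h3⟩ := hf
  refine ⟨h0.const_smul c, fun j => c • F j, fun j hj => (h1 j hj).const_smul c,
    fun j hj γ => ?_, fun γ hγ z => ?_⟩
  · rw [ModularForm.SL_smul_slash]
    exact (h2 j hj γ).const_smul_left c
  · rw [ModularForm.SL_smul_slash, Pi.smul_apply, h3 γ hγ z, Finset.smul_sum]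
    exact Finset.sum_congr rfl fun j _ => by simp [mul_assoc]

open Polynomial in
lemma sum_mul_sum_pow (s t : ℕ) (a b : ℕ → ℂ) (ha : ∀ j, s < j → a j = 0)
    (hb : ∀ j, t < j → b j = 0) (x : ℂ) :
    (∑ j ∈ Finset.range (s + 1), a j * x ^ j) * (∑ j ∈ Finset.range (t + 1), b j * x ^ j) =
      ∑ n ∈ Finset.range (s + t + 1),
        (∑ p ∈ Finset.HasAntidiagonal.antidiagonal n, a p.1 * b p.2) * x ^ n := by
  set P : ℂ[X] := ∑ j ∈ Finset.range (s + 1), C (a j) * X ^ j with hP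
  set Q : ℂ[X] := ∑ j ∈ Finset.range (t + 1), C (b j) * X ^ j with hQ
  have cP : ∀ j, P.coeff j = a j := by
    intro j
    simp only [hP, finsetSum_coeff, coeff_C_mul_X_pow]
    by_cases hj : j < s + 1
    · simp [Finset.sum_ite_eq, hj]
    · rw [ha j (by lia)]
      exact Finset.sum_eq_zero fun i hi => if_neg (by rw [Finset.mem_range] at hi; lia)
  have cQ : ∀ j, Q.coeff j = b j := by
    intro j
    simp only [hQ, finsetSum_coeff, coeff_C_mul_X_pow]
    by_cases hj : j < t + 1
    · simp [Finset.sum_ite_eq, hj]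
    · rw [hb j (by lia)]
      exact Finset.sum_eq_zero fun i hi => if_neg (by rw [Finset.mem_range] at hi; lia)
  have dP : P.natDegree ≤ s := natDegree_le_iff_coeff_eq_zero.mpr fun j hj => by
    rw [cP, ha j hj]
  have dQ : Q.natDegree ≤ t := natDegree_le_iff_coeff_eq_zero.mpr fun j hj => by
    rw [cQ, hb j hj]
  have e1 : P.eval x = ∑ j ∈ Finset.range (s + 1), a j * x ^ j := by
    simp [hP, eval_finsetSum]
  have e2 : Q.eval x = ∑ j ∈ Finset.range (t + 1), b j * x ^ j := by
    simp [hQ, eval_finsetSum]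
  rw [← e1, ← e2, ← eval_mul, eval_eq_sum_range' (n := s + t + 1)]
  · refine Finset.sum_congr rfl fun n _ => ?_
    rw [coeff_mul]
    simp only [cP, cQ]
  · exact Nat.lt_succ_of_le (natDegree_mul_le.trans (add_le_add dP dQ))

lemma mdifferentiable_finset_sum {ι : Type*} (s : Finset ι) (f : ι → ℍ → ℂ)
    (h : ∀ i ∈ s, MDiff (f i)) : MDiff (∑ i ∈ s, f i) := by
  classical
  induction s using Finset.induction_on with
  | empty => simpa using! (mdifferentiable_const : MDiff (fun _ : ℍ => (0 : ℂ)))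
  | insert a s ha ih =>
    rw [Finset.sum_insert ha]
    exact (h a (by simp)).add (ih fun i hi => h i (by simp [hi]))

lemma isBoundedAtImInfty_finset_sum {ι : Type*} (s : Finset ι) (f : ι → ℍ → ℂ)
    (h : ∀ i ∈ s, IsBoundedAtImInfty (f i)) : IsBoundedAtImInfty (∑ i ∈ s, f i) := by
  classical
  induction s using Finset.induction_on with
  | empty => simpa using! Filter.const_boundedAtFilter atImInfty (0 : ℂ)
  | insert a s ha ih =>
    rw [Finset.sum_insert ha]
    exact (h a (by simp)).add (ih fun i hi => h i (by simp [hi]))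

lemma IsQuasimodular.mul {N M k l s t : ℕ} {f g : ℍ → ℂ} (hf : IsQuasimodular N k s f)
    (hg : IsQuasimodular M l t g) : IsQuasimodular (N * M) (k + l) (s + t) (f * g) := by
  obtain ⟨F, hF1, hF2, hF0, hF⟩ := hf.exists_ext
  obtain ⟨G, hG1, hG2, hG0, hG⟩ := hg.exists_ext
  refine ⟨hf.1.mul hg.1, fun n => ∑ p ∈ Finset.HasAntidiagonal.antidiagonal n, F p.1 * G p.2,
    fun n _ => mdifferentiable_finset_sum _ _ fun p _ => (hF1 _).mul (hG1 _),
    fun n _ γ => ?_, fun γ hγ z => ?_⟩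
  · rw [SlashAction.sum_slash]
    refine isBoundedAtImInfty_finset_sum _ _ fun p hp => ?_
    have hw : ((k + l : ℕ) : ℤ) - 2 * n = ((k : ℤ) - 2 * p.1) + ((l : ℤ) - 2 * p.2) := by
      rw [Finset.HasAntidiagonal.mem_antidiagonal] at hp
      rw [← hp]; push_cast; ring
    rw [hw, ModularForm.mul_slash_SL2]
    exact (hF2 _ γ).mul (hG2 _ γ)
  · rw [Nat.cast_add, ModularForm.mul_slash_SL2, Pi.mul_apply,
      hF s le_rfl γ (Gamma_le_of_dvd (Dvd.intro M rfl) hγ) z,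
      hG t le_rfl γ (Gamma_le_of_dvd (Dvd.intro_left N rfl) hγ) z,
      sum_mul_sum_pow s t (fun j => F j z) (fun j => G j z)
        (fun j hj => by simp [hF0 j hj]) (fun j hj => by simp [hG0 j hj])]
    exact Finset.sum_congr rfl fun n _ => by simp [Finset.sum_apply]

lemma IsModular.isQuasimodular {N k : ℕ} {f : ℍ → ℂ} (hf : IsModular N k f) :
    IsQuasimodular N k 0 f := by
  refine ⟨hf.2.1, fun _ => f, fun _ _ => hf.2.1, fun j hj γ => ?_, fun γ hγ z => ?_⟩
  · obtain rfl : j = 0 := by lia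
    simpa using hf.2.2 γ
  · rw [hf.1 γ hγ]; simp

/-- `QM_k`: functions on `ℍ` which are quasimodular forms of weight `k`, of some level `N ≥ 1`
and some depth. -/
def qmTower (k : ℕ) : Submodule ℂ (ℍ → ℂ) where
  carrier := {f | ∃ N : ℕ, N ≠ 0 ∧ ∃ s : ℕ, IsQuasimodular N k s f}
  zero_mem' := by
    obtain ⟨N, hN, h⟩ := mem_modTower.mp (modTower k).zero_mem
    exact ⟨N, hN, 0, h.isQuasimodular⟩
  add_mem' := by
    rintro f g ⟨N, hN, s, hf⟩ ⟨M, hM, t, hg⟩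
    exact ⟨N * M, mul_ne_zero hN hM, _, hf.add hg⟩
  smul_mem' := by
    rintro c f ⟨N, hN, s, hf⟩
    exact ⟨N, hN, s, hf.smul c⟩

lemma modTower_le_qmTower (k : ℕ) : modTower k ≤ qmTower k := by
  intro f hf
  obtain ⟨N, hN, h⟩ := mem_modTower.mp hf
  exact ⟨N, hN, 0, h.isQuasimodular⟩

instance : SetLike.GradedMonoid qmTower where
  one_mem := modTower_le_qmTower 0 SetLike.GradedOne.one_mem
  mul_mem := by
    rintro i j f g ⟨N, hN, s, hf⟩ ⟨M, hM, t, hg⟩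
    exact ⟨N * M, mul_ne_zero hN hM, _, hf.mul hg⟩

/-- The quasimodular tower `QM = ⨁ₖ QMₖ`, a graded commutative `ℂ`-algebra. -/
def QMTower : Type := ⨁ k : ℕ, qmTower k

instance : CommRing QMTower := inferInstanceAs (CommRing (⨁ k : ℕ, qmTower k))

instance : Algebra ℂ QMTower := inferInstanceAs (Algebra ℂ (⨁ k : ℕ, qmTower k))

/-- The inclusion `QMₖ → QM` of the component of weight `k`. -/
def ofQM (k : ℕ) : qmTower k →ₗ[ℂ] QMTower := DirectSum.lof ℂ ℕ (fun k => qmTower k) k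

lemma ofQM_mul {i j : ℕ} (f : qmTower i) (g : qmTower j) :
    ofQM i f * ofQM j g = ofQM (i + j) ⟨f * g, SetLike.GradedMul.mul_mem f.2 g.2⟩ :=
  by
  exact DirectSum.of_mul_of (A := fun k => qmTower k) f g

/-- Linear maps out of the modular tower, given weight by weight. -/
def liftM {V : Type*} [AddCommGroup V] [Module ℂ V] (φ : ∀ k, modTower k →ₗ[ℂ] V) :
    ModTower →ₗ[ℂ] V where
  toFun x := DirectSum.toModule ℂ ℕ V φ x
  map_add' x y := LinearMap.map_add (DirectSum.toModule ℂ ℕ V φ) x y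
  map_smul' c x := LinearMap.map_smul (DirectSum.toModule ℂ ℕ V φ) c x

lemma liftM_of {V : Type*} [AddCommGroup V] [Module ℂ V] (φ : ∀ k, modTower k →ₗ[ℂ] V) (k : ℕ)
    (f : modTower k) : liftM φ (ofM k f) = φ k f :=
  DirectSum.toModule_lof (φ := φ) ℂ k f

/-- The inclusion `M → QM` of the modular tower in the quasimodular tower. -/
def inclM : ModTower →ₗ[ℂ] QMTower :=
  liftM fun k => ofQM k ∘ₗ Submodule.inclusion (modTower_le_qmTower k)

/-! ### The Eisenstein series `G₂` and expansions in `G₂` -/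

/-- `G₂(z) = -B₂/4 + ∑_{n ≥ 1} (∑_{d ∣ n} d) e^{2πinz}`. -/
def G2 (z : ℍ) : ℂ :=
  -((bernoulli 2 : ℚ) : ℂ) / 4 +
    ∑' n : ℕ+, ((∑ d ∈ (n : ℕ).divisors, d : ℕ) : ℂ) * exp (2 * Real.pi * I * n * z)

lemma G2_eq : G2 = (-1 / 24 : ℂ) • EisensteinSeries.E2 := by
  ext z
  have h : ∀ n : ℕ+, ((∑ d ∈ (n : ℕ).divisors, d : ℕ) : ℂ) * exp (2 * Real.pi * I * n * z) =
      (ArithmeticFunction.sigma 1 n : ℂ) * exp (2 * Real.pi * I * z) ^ (n : ℕ) := by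
    intro n
    rw [ArithmeticFunction.sigma_one_apply, ← Complex.exp_nat_mul]
    congr 2
    ring
  rw [G2, tsum_congr h, Pi.smul_apply, EisensteinSeries.E2_eq_tsum_cexp, bernoulli_two,
    smul_eq_mul]
  push_cast
  ring

lemma E2_slash_apply (γ : SL(2, ℤ)) (z : ℍ) : (EisensteinSeries.E2 ∣[(2 : ℤ)] γ) z =
    EisensteinSeries.E2 z - 6 * I / Real.pi * ((γ 1 0 : ℂ) / denom γ z) := by
  rw [EisensteinSeries.E2_slash_action]
  have hpi : (Real.pi : ℂ) ≠ 0 := ofReal_ne_zero.mpr Real.pi_ne_zero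
  simp only [Pi.sub_apply, Pi.smul_apply, EisensteinSeries.D2, riemannZeta_two, smul_eq_mul]
  field_simp

lemma isBoundedAtImInfty_div_denom (γ : SL(2, ℤ)) :
    IsBoundedAtImInfty fun z : ℍ => (γ 1 0 : ℂ) / denom γ z := by
  rw [isBoundedAtImInfty_iff]
  refine ⟨1, 1, fun z hz => ?_⟩
  by_cases hc : γ 1 0 = 0
  · simp [hc]
  have h1 : |(γ 1 0 : ℝ)| * z.im ≤ ‖(denom γ z : ℂ)‖ := by
    have := abs_im_le_norm (denom γ z : ℂ)
    simpa [denom, abs_mul, abs_of_pos z.im_pos] using this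
  have h2 : |(γ 1 0 : ℝ)| ≤ ‖(denom γ z : ℂ)‖ :=
    le_trans (le_mul_of_one_le_right (abs_nonneg _) hz) h1
  rw [norm_div, norm_intCast]
  exact div_le_one_of_le₀ h2 (norm_nonneg _)

lemma isBoundedAtImInfty_G2_slash (γ : SL(2, ℤ)) : IsBoundedAtImInfty (G2 ∣[(2 : ℤ)] γ) := by
  rw [G2_eq, ModularForm.SL_smul_slash]
  have h : EisensteinSeries.E2 ∣[(2 : ℤ)] γ = EisensteinSeries.E2 -
      (6 * I / Real.pi) • fun z : ℍ => (γ 1 0 : ℂ) / denom γ z :=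
    funext fun z => E2_slash_apply γ z
  rw [h]
  have hb : IsBoundedAtImInfty (EisensteinSeries.E2 -
      (6 * I / Real.pi) • fun z : ℍ => (γ 1 0 : ℂ) / denom γ z) :=
    EisensteinSeries.isBoundedAtImInfty_E2.sub
      ((isBoundedAtImInfty_div_denom γ).const_smul_left _)
  exact hb.const_smul_left _

lemma isQuasimodular_G2 : IsQuasimodular 1 2 1 G2 := by
  have hG : MDiff G2 := by
    rw [G2_eq]
    exact E2_mdifferentiable.const_smul _
  refine ⟨hG, fun j => if j = 0 then G2 else fun _ => I / (4 * Real.pi), fun j _ => ?_,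
    fun j hj γ => ?_, fun γ _ z => ?_⟩
  · dsimp only
    split_ifs
    · exact hG
    · exact mdifferentiable_const
  · dsimp only
    split_ifs with h
    · subst h
      simpa using isBoundedAtImInfty_G2_slash γ
    · obtain rfl : j = 1 := by lia
      have e : ((fun _ => I / (4 * Real.pi) : ℍ → ℂ) ∣[((2 : ℕ) : ℤ) - 2 * ((1 : ℕ) : ℤ)] γ) =
          fun _ => I / (4 * Real.pi) :=
        ModularForm.is_invariant_const γ (I / (4 * Real.pi))
      rw [e]
      exact Filter.const_boundedAtFilter _ _
  · have hpi : (Real.pi : ℂ) ≠ 0 := ofReal_ne_zero.mpr Real.pi_ne_zero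
    have h : (G2 ∣[(2 : ℤ)] γ) z = G2 z + I / (4 * Real.pi) * ((γ 1 0 : ℂ) / denom γ z) := by
      rw [G2_eq, ModularForm.SL_smul_slash, Pi.smul_apply, E2_slash_apply, Pi.smul_apply,
        smul_eq_mul, smul_eq_mul]
      field_simp
      ring
    simpa [Finset.sum_range_succ] using h

lemma G2_mem : G2 ∈ qmTower 2 := ⟨1, one_ne_zero, 1, isQuasimodular_G2⟩

/-- `G₂` as an element of the quasimodular tower. -/
def G2' : QMTower := ofQM 2 ⟨G2, G2_mem⟩

/-- Evaluation of a polynomial `∑ᵢ aᵢ Tⁱ` with coefficients `aᵢ` in the modular tower at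
`T = G₂`. -/
def evalG2 : (ℕ →₀ ModTower) →ₗ[ℂ] QMTower :=
  Finsupp.lsum ℂ fun i =>
    { toFun := fun a => inclM a * G2' ^ i
      map_add' := fun a b => by rw [map_add, add_mul]
      map_smul' := fun c a => by
        rw [map_smul, RingHom.id_apply]
        exact Algebra.smul_mul_assoc c _ _ }

lemma exists_generalized_inverse {V W : Type*} [AddCommGroup V] [Module ℂ V] [AddCommGroup W]
    [Module ℂ W] (f : V →ₗ[ℂ] W) : ∃ e : W →ₗ[ℂ] V, f ∘ₗ e ∘ₗ f = f := by
  obtain ⟨g, hg⟩ := f.rangeRestrict.exists_rightInverse_of_surjective f.range_rangeRestrict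
  obtain ⟨e, he⟩ := g.exists_extend
  refine ⟨e, LinearMap.ext fun p => ?_⟩
  have h1 : e (f p) = g (f.rangeRestrict p) := LinearMap.congr_fun he (f.rangeRestrict p)
  have h2 := congrArg Subtype.val (LinearMap.congr_fun hg (f.rangeRestrict p))
  simpa [h1] using h2

/-- The coefficients `(aᵢ(f))ᵢ` of `f ∈ QM` in its expansion `f = ∑ᵢ aᵢ(f) G₂ⁱ`, `aᵢ(f) ∈ M`.
By the structure theorem for quasimodular forms every `f ∈ QM` has exactly one such expansion,
so that `evalG2` is bijective and `expansion` is its inverse. To avoid putting that theorem into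
the definition, `expansion` is defined as a linear map with `evalG2 ∘ expansion ∘ evalG2 =
evalG2`, which exists in any case. -/
def expansion : QMTower →ₗ[ℂ] (ℕ →₀ ModTower) := (exists_generalized_inverse evalG2).choose

/-- The operator `∑ᵢ aᵢ(f) G₂ⁱ ↦ ∑ᵢ T(aᵢ(f)) G₂ⁱ` on `QM` given by an operator `T` on `M`. -/
def extendToQM (T : ModTower →ₗ[ℂ] ModTower) : QMTower →ₗ[ℂ] QMTower :=
  evalG2 ∘ₗ Finsupp.mapRange.linearMap T ∘ₗ expansion

/-! ### The operations `‖α`, `α ∈ GL₂⁺(ℚ)` -/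

/-- The image in `GL₂(ℝ)` of an element of `GL₂⁺(ℚ)`. -/
def toReal (α : GL(2, ℚ)⁺) : GL (Fin 2) ℝ :=
  Matrix.GeneralLinearGroup.map (algebraMap ℚ ℝ) (α : GL (Fin 2) ℚ)

/-- `(f|ₖα)(z) = (cz+d)⁻ᵏ f((az+b)/(cz+d))`. -/
def slashFun (k : ℕ) (α : GL(2, ℚ)⁺) (f : ℍ → ℂ) (z : ℍ) : ℂ :=
  (denom (toReal α) z ^ k)⁻¹ * f (toReal α • z)

lemma toReal_det_pos (α : GL(2, ℚ)⁺) : 0 < (toReal α).det.val := by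
  have h : 0 < (α : GL (Fin 2) ℚ).det.val := α.2
  have h2 : (toReal α).det.val = (((α : GL (Fin 2) ℚ).det.val : ℚ) : ℝ) := by
    simp [toReal, Matrix.det_fin_two]
  rw [h2]
  exact_mod_cast h

lemma slashFun_eq (k : ℕ) (α : GL(2, ℚ)⁺) (f : ℍ → ℂ) :
    slashFun k α f =
      ((((toReal α).det.val : ℂ) ^ ((k : ℤ) - 1))⁻¹) • (f ∣[(k : ℤ)] toReal α) := by
  have h := toReal_det_pos α
  have h' : ((toReal α).det.val : ℂ) ^ ((k : ℤ) - 1) ≠ 0 :=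
    zpow_ne_zero _ (ofReal_ne_zero.mpr h.ne')
  ext z
  rw [Pi.smul_apply, ModularForm.slash_apply, σ, if_pos h, abs_of_pos h, smul_eq_mul, slashFun,
    zpow_neg, zpow_natCast, ContinuousAlgEquiv.refl_apply]
  field_simp

open Pointwise in
lemma slashFun_mem {k : ℕ} (α : GL(2, ℚ)⁺) {f : ℍ → ℂ} (hf : f ∈ modTower k) :
    slashFun k α f ∈ modTower k := by
  rw [slashFun_eq]
  refine (modTower k).smul_mem _ ?_
  obtain ⟨M, hM, g, rfl⟩ := hf
  have : NeZero M := ⟨hM⟩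
  obtain ⟨N, hN, hle⟩ := exists_Gamma_le_conj' (α : GL (Fin 2) ℚ) M
  have hle' : (Gamma N).map (mapGL ℝ) ≤
      ConjAct.toConjAct (toReal α)⁻¹ • (Gamma M).map (mapGL ℝ) := by
    intro x hx
    rw [Subgroup.mem_pointwise_smul_iff_inv_smul_mem, ← map_inv, inv_inv]
    exact hle (Subgroup.smul_mem_pointwise_smul _ _ _ hx)
  let t := ModularForm.translate g (toReal α)
  exact ⟨N, hN, ⟨⟨t, fun γ hγ => t.slash_action_eq' γ (hle' hγ)⟩, t.holo',
    fun hc => t.bdd_at_cusps' (hc.mono hle')⟩, rfl⟩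

/-- The action of `α` on the modular tower, `f ↦ f|ₖα` in weight `k`. -/
def slashM (α : GL(2, ℚ)⁺) : ModTower →ₗ[ℂ] ModTower :=
  liftM fun k => ofM k ∘ₗ
    { toFun := fun f => ⟨slashFun k α f, slashFun_mem α f.2⟩
      map_add' := fun _ _ => Subtype.ext <| funext fun _ => mul_add _ _ _
      map_smul' := fun _ _ => Subtype.ext <| funext fun _ => mul_left_comm _ _ _ }

/-- `f‖α = ∑ᵢ (aᵢ(f)|α) G₂ⁱ`. -/
def slashQM (α : GL(2, ℚ)⁺) : QMTower →ₗ[ℂ] QMTower := extendToQM (slashM α)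

/-! ### The operators `X` and `Y` -/

/-- `Δ(z) = (2π)¹² q ∏_{n ≥ 1} (1 - qⁿ)²⁴`, `q = e^{2πiz}`. -/
def Delta (z : ℂ) : ℂ :=
  (2 * Real.pi) ^ 12 * exp (2 * Real.pi * I * z) *
    ∏' n : ℕ, (1 - exp (2 * Real.pi * I * z) ^ (n + 1)) ^ 24

/-- `X(f) = (1/2πi) f' - (1/12πi) (d/dz log Δ) · (k/2) f` in weight `k`. -/
def XFun (k : ℕ) (f : ℍ → ℂ) (z : ℍ) : ℂ :=
  1 / (2 * Real.pi * I) * deriv (f ∘ ofComplex) z -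
    1 / (12 * Real.pi * I) * logDeriv Delta z * ((k / 2 : ℂ) * f z)

lemma Delta_eq (z : ℍ) : Delta z = (2 * Real.pi) ^ 12 * ModularForm.eta z ^ 24 := by
  have h := ModularForm.discriminant_eq_q_prod z
  simp only [ModularForm.discriminant, ModularForm.eta_q_eq_pow, Function.Periodic.qParam,
    ofReal_one, div_one] at h
  rw [h, Delta, mul_assoc]

lemma logDeriv_Delta (z : ℍ) :
    logDeriv Delta z = 2 * Real.pi * I * EisensteinSeries.E2 z := by
  have h : Delta =ᶠ[nhds (z : ℂ)] fun w => (2 * Real.pi : ℂ) ^ 12 * ModularForm.eta w ^ 24 := by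
    filter_upwards [isOpen_upperHalfPlaneSet.mem_nhds z.im_pos] with w hw
    exact Delta_eq ⟨w, hw⟩
  have hpi : (2 * Real.pi : ℂ) ^ 12 ≠ 0 := by
    simp [Real.pi_ne_zero]
  rw [logDeriv_apply, h.deriv_eq, h.eq_of_nhds, ← logDeriv_apply, logDeriv_const_mul _ _ hpi,
    logDeriv_fun_pow (ModularForm.differentiableAt_eta_of_mem_upperHalfPlaneSet z.im_pos),
    ModularForm.logDeriv_eta_eq_E2]
  push_cast
  ring

lemma XFun_eq (k : ℕ) (f : ℍ → ℂ) : XFun k f = Derivative.serreDerivative k f := by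
  ext z
  have hpi : (Real.pi : ℂ) ≠ 0 := ofReal_ne_zero.mpr Real.pi_ne_zero
  rw [XFun, logDeriv_Delta, Derivative.serreDerivative_apply,
    Derivative.normalizedDerivOfComplex]
  field_simp

lemma isBoundedAtImInfty_D {f : ℍ → ℂ} (hf : MDiff f) (hb : IsBoundedAtImInfty f) :
    IsBoundedAtImInfty (Derivative.normalizedDerivOfComplex f) := by
  rw [isBoundedAtImInfty_iff] at hb ⊢
  obtain ⟨M, A, h⟩ := hb
  refine ⟨‖(2 * Real.pi * I : ℂ)⁻¹‖ * M, max A 1 + 1, fun z hz => ?_⟩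
  rw [Derivative.normalizedDerivOfComplex, norm_mul]
  refine mul_le_mul_of_nonneg_left ?_ (norm_nonneg _)
  have key : ∀ w ∈ Metric.closedBall (z : ℂ) 1, max A 1 ≤ w.im := by
    intro w hw
    rw [Metric.mem_closedBall, Complex.dist_eq] at hw
    have h1 := (abs_im_le_norm (w - z)).trans hw
    rw [sub_im, abs_le] at h1
    have h2 : (z : ℂ).im = z.im := rfl
    linarith [h1.1]
  have hpos : ∀ w ∈ Metric.closedBall (z : ℂ) 1, 0 < w.im := fun w hw =>
    lt_of_lt_of_le (lt_of_lt_of_le one_pos (le_max_right A 1)) (key w hw)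
  have hd : DiffContOnCl ℂ (f ∘ ofComplex) (Metric.ball (z : ℂ) 1) := by
    refine DifferentiableOn.diffContOnCl_ball (U := upperHalfPlaneSet) ?_ hpos
    exact UpperHalfPlane.mdifferentiable_iff.mp hf
  have := norm_deriv_le_of_forall_mem_sphere_norm_le (C := M) one_pos hd fun w hw => ?_
  · simpa using this
  · have hw' := Metric.sphere_subset_closedBall hw
    rw [Function.comp_apply, ofComplex_apply_of_im_pos (hpos w hw')]
    exact h _ ((le_max_left A 1).trans (key w hw'))

lemma XFun_mem {k : ℕ} {f : ℍ → ℂ} (hf : f ∈ modTower k) : XFun k f ∈ modTower (k + 2) := by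
  obtain ⟨N, hN, h1, h2, h3⟩ := mem_modTower.mp hf
  rw [XFun_eq]
  refine mem_modTower.mpr ⟨N, hN, fun γ hγ => ?_,
    Derivative.serreDerivative_mdifferentiable _ h2, fun γ => ?_⟩
  · have := Derivative.serreDerivative_slash_equivariant (k := k) h2 (γ := γ)
    rw [h1 γ hγ] at this
    exact_mod_cast this
  · have := Derivative.serreDerivative_slash_equivariant (k := k) h2 (γ := γ)
    have hb : IsBoundedAtImInfty
        (Derivative.serreDerivative ((k : ℤ) : ℂ) (f ∣[(k : ℤ)] γ)) := by
      have e : Derivative.serreDerivative ((k : ℤ) : ℂ) (f ∣[(k : ℤ)] γ) =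
          Derivative.normalizedDerivOfComplex (f ∣[(k : ℤ)] γ) -
            (((k : ℤ) : ℂ) * 12⁻¹) • (EisensteinSeries.E2 * (f ∣[(k : ℤ)] γ)) := by
        ext z
        simp [mul_assoc]
      rw [e]
      exact (isBoundedAtImInfty_D (h2.slash _ _) (h3 γ)).sub
        ((EisensteinSeries.isBoundedAtImInfty_E2.mul (h3 γ)).const_smul_left _)
    rw [← this] at hb
    exact_mod_cast hb

lemma mdiff_of_mem {k : ℕ} {f : ℍ → ℂ} (hf : f ∈ modTower k) : MDiff f := by
  obtain ⟨N, -, h⟩ := mem_modTower.mp hf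
  exact h.2.1

/-- `X : Mₖ → Mₖ₊₂` on the modular tower. -/
def XM : ModTower →ₗ[ℂ] ModTower :=
  liftM fun k => ofM (k + 2) ∘ₗ
      { toFun := fun f => ⟨XFun k f, XFun_mem f.2⟩
        map_add' := fun f g => Subtype.ext <| by
          simp only [XFun_eq, Submodule.coe_add]
          exact Derivative.serreDerivative_add _ _ _ (mdiff_of_mem f.2) (mdiff_of_mem g.2)
        map_smul' := fun c f => Subtype.ext <| by
          simp only [XFun_eq, Submodule.coe_smul, RingHom.id_apply]
          exact Derivative.serreDerivative_smul _ _ _ (mdiff_of_mem f.2) }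

/-- `Y : Mₖ → Mₖ`, `Y(f) = (k/2) f`. -/
def YM : ModTower →ₗ[ℂ] ModTower :=
  liftM fun k => (k / 2 : ℂ) • ofM k

/-- `X(f) = ∑ᵢ X(aᵢ(f)) G₂ⁱ` on the quasimodular tower. -/
def XQM : QMTower →ₗ[ℂ] QMTower := extendToQM XM

/-- `Y(f) = ∑ᵢ Y(aᵢ(f)) G₂ⁱ` on the quasimodular tower. -/
def YQM : QMTower →ₗ[ℂ] QMTower := extendToQM YM

/-! ### Twisted quasimodular Hecke operators -/

/-- The inclusion `SL₂(ℤ) → GL₂⁺(ℚ)`. -/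
def slToGL : SL(2, ℤ) →* GL(2, ℚ)⁺ :=
  toGLPos.comp (Matrix.SpecialLinearGroup.map (Int.castRingHom ℚ))

/-- The set `Γ(N) \ GL₂⁺(ℚ)` of cosets `Γ(N)α`. -/
abbrev Cosets (N : ℕ) : Type :=
  Quotient (QuotientGroup.rightRel ((Gamma N).map slToGL))

/-- The coset `Γ(N)α`. -/
def coset (N : ℕ) (α : GL(2, ℚ)⁺) : Cosets N :=
  Quotient.mk (QuotientGroup.rightRel ((Gamma N).map slToGL)) α

/-- `Q_σ(Γ(N))`: functions `F : Γ(N) \ GL₂⁺(ℚ) → QM` of finite support with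
`F_{αγ} = F_α ‖ σγσ⁻¹` for `γ ∈ Γ(N)`. -/
def Qtw (N : ℕ) (σ : SL(2, ℤ)) : Submodule ℂ (Cosets N → QMTower) where
  carrier := {F | F.support.Finite ∧ ∀ γ ∈ Gamma N, ∀ α : GL(2, ℚ)⁺,
    F (coset N (α * slToGL γ)) = slashQM (slToGL (σ * γ * σ⁻¹)) (F (coset N α))}
  zero_mem' := ⟨by simp, fun γ _ α => by simp⟩
  add_mem' := fun hF hG => ⟨(hF.1.union hG.1).subset (Function.support_add _ _),
    fun γ hγ α => by
      rw [Pi.add_apply, Pi.add_apply, hF.2 γ hγ α, hG.2 γ hγ α, map_add]⟩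
  smul_mem' := fun c F hF => ⟨hF.1.subset (Function.support_const_smul_subset c F),
    fun γ hγ α => by rw [Pi.smul_apply, Pi.smul_apply, hF.2 γ hγ α, map_smul]⟩

/-- The value `F_α ∈ QM`. -/
def valueAt {N : ℕ} {σ : SL(2, ℤ)} (F : Qtw N σ) (α : GL(2, ℚ)⁺) : QMTower :=
  (F : Cosets N → QMTower) (coset N α)

/-- The set `Γ(N) \ SL₂(ℤ)`. -/
abbrev SLCosets (N : ℕ) : Type := Quotient (QuotientGroup.rightRel (Gamma N))

/-- `∑_β F¹_{βσ} · (F²_{ασ⁻¹β⁻¹} ‖ σβ)`, where `β = r q` runs over a system `r` of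
representatives of the finitely many cosets `q ∈ Γ(N) \ SL₂(ℤ)`. -/
def pairingFormula {N : ℕ} {σ : SL(2, ℤ)} (r : SLCosets N → SL(2, ℤ)) (F₁ F₂ : Qtw N σ)
    (α : GL(2, ℚ)⁺) : QMTower :=
  ∑ᶠ q : SLCosets N, valueAt F₁ (slToGL (r q * σ)) *
    slashQM (slToGL (σ * r q)) (valueAt F₂ (α * slToGL (σ⁻¹ * (r q)⁻¹)))

/-! ### The Lie algebra `l₁` and its enveloping algebra -/

/-- The Lie algebra `l₁` over `ℂ`, with basis `X = (1, 0)`, `Y = (0, 1)` and `[Y, X] = X`. -/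
def L1 : Type := ℂ × ℂ

instance : AddCommGroup L1 := inferInstanceAs (AddCommGroup (ℂ × ℂ))

instance : Module ℂ L1 := inferInstanceAs (Module ℂ (ℂ × ℂ))

/-- The generator `X`. -/
def L1.X : L1 := ((1 : ℂ), (0 : ℂ))

/-- The generator `Y`. -/
def L1.Y : L1 := ((0 : ℂ), (1 : ℂ))

instance : Bracket L1 L1 where
  bracket u v := (u.2 * v.1 - u.1 * v.2, (0 : ℂ))

lemma L1.lie_fst (u v : L1) : ⁅u, v⁆.1 = u.2 * v.1 - u.1 * v.2 := rfl

lemma L1.lie_snd (u v : L1) : ⁅u, v⁆.2 = 0 := rfl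

lemma L1.ext' {u v : L1} (h1 : u.1 = v.1) (h2 : u.2 = v.2) : u = v := Prod.ext h1 h2

lemma L1.add_fst (u v : L1) : (u + v).1 = u.1 + v.1 := rfl

lemma L1.add_snd (u v : L1) : (u + v).2 = u.2 + v.2 := rfl

lemma L1.smul_fst (c : ℂ) (u : L1) : (c • u).1 = c * u.1 := rfl

lemma L1.smul_snd (c : ℂ) (u : L1) : (c • u).2 = c * u.2 := rfl

instance : LieRing L1 where
  add_lie u v w := by
    refine L1.ext' ?_ ?_ <;> simp only [L1.lie_fst, L1.lie_snd, L1.add_fst, L1.add_snd] <;> ring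
  lie_add u v w := by
    refine L1.ext' ?_ ?_ <;> simp only [L1.lie_fst, L1.lie_snd, L1.add_fst, L1.add_snd] <;> ring
  lie_self u := by
    refine L1.ext' ?_ rfl
    show u.2 * u.1 - u.1 * u.2 = 0
    ring
  leibniz_lie u v w := by
    refine L1.ext' ?_ ?_ <;> simp only [L1.lie_fst, L1.lie_snd, L1.add_fst, L1.add_snd] <;> ring

instance : LieAlgebra ℂ L1 where
  lie_smul c u v := by
    refine L1.ext' ?_ ?_ <;> simp only [L1.lie_fst, L1.lie_snd, L1.smul_fst, L1.smul_snd] <;> ring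

lemma L1.lie_Y_X : ⁅L1.Y, L1.X⁆ = L1.X := by
  refine L1.ext' ?_ rfl
  show (1 : ℂ) * 1 - 0 * 0 = 1
  norm_num

/-- The enveloping algebra `h₁ = U(l₁)`. -/
abbrev H1 : Type := UniversalEnvelopingAlgebra ℂ L1

/-- The coproduct `Δ : h₁ → h₁ ⊗ h₁`, the algebra map with `Δ(u) = u ⊗ 1 + 1 ⊗ u` for
`u ∈ l₁`. -/
def coproduct : H1 →ₐ[ℂ] H1 ⊗[ℂ] H1 :=
  UniversalEnvelopingAlgebra.lift ℂ
    { toFun := fun u => UniversalEnvelopingAlgebra.ι ℂ u ⊗ₜ[ℂ] (1 : H1) +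
        (1 : H1) ⊗ₜ[ℂ] UniversalEnvelopingAlgebra.ι ℂ u
      map_add' := fun u v => by
        simp only [map_add, TensorProduct.add_tmul, TensorProduct.tmul_add]
        abel
      map_smul' := fun c u => by
        simp only [map_smul, TensorProduct.smul_tmul', TensorProduct.tmul_smul, smul_add,
          RingHom.id_apply]
      map_lie' := fun {u v} => by
        simp only [LieHom.map_lie, LieRing.of_associative_ring_bracket, TensorProduct.sub_tmul,
          TensorProduct.tmul_sub, add_mul, mul_add, Algebra.TensorProduct.tmul_mul_tmul, one_mul,
          mul_one]
        abel }

end QMHecke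

end

/-! At a fixed point `z` the quantities `c / (cz + d)`, for matrices in `Γ(N)`, take infinitely many
values. An identity in these quantities that holds for all of `Γ(N)` is therefore an identity of
polynomials, and coefficients may be compared. This yields the structure theorem `QM = M[G₂]`. The
top coefficient of a quasimodular form is modular (`slash_top_coeff`). Since `G₂|γ = G₂ + (i/4π)
c/(cz + d)`, subtracting a multiple of a power of `G₂` lowers the depth
(`IsQuasimodular.exists_sub`), and powers of `G₂` are independent over modular forms
(`eq_zero_of_sum_mul_G2_pow`). Hence `expansion` inverts `evalG2`, and `‖α`, `X`, `Y` act on the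
coefficients alone.

Identities on `M` now pass to `QM`: `‖γ` for `γ ∈ SL₂(ℤ)` is a multiplicative right action, `X` (a
Serre derivative) and `Y` are derivations commuting with it, and `[Y, X] = X`.

For the pairing, replacing `β` by `γβ` with `γ ∈ Γ(N)` leaves a summand unchanged
(`pairTerm_mul_left`), while replacing `(α, β)` by `(αγ, βσγσ⁻¹)` applies `‖σγσ⁻¹` to it
(`pairTerm_mul_right`). The first gives independence of representatives; the second, after
reindexing the finite coset space, gives the transformation law.

`X` and `Y` satisfy the Leibniz rule in every summand, so `l₁` acts by derivations of the pairing.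
That is the coproduct formula on the generators of `h₁`, and since the coproduct is an algebra map
it extends to all of `h₁` (`lift_apply_eq_coproduct`). -/

noncomputable section

namespace QMHecke

/-! ### Coefficients of quasimodular forms -/

/-- The quantity `c / (cz + d)`. -/
def ratio (γ : SL(2, ℤ)) (z : ℍ) : ℂ := (γ 1 0 : ℂ) / denom γ z

/-- Up to notation this is the logarithmic derivative of the cocycle relation for `cz + d`; the
factor `(denom δ z)⁻²` is the derivative of `z ↦ δ • z`. -/
lemma ratio_mul (γ δ : SL(2, ℤ)) (z : ℍ) :
    ratio (γ * δ) z = ratio γ (δ • z) * (denom δ z ^ 2)⁻¹ + ratio δ z := by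
  have h1 : denom ((γ * δ : SL(2, ℤ)) : GL (Fin 2) ℝ) z =
      denom γ (δ • z : ℍ) * denom δ z := by
    rw [map_mul]
    have h2 := denom_cocycle_σ (γ : GL (Fin 2) ℝ) (δ : GL (Fin 2) ℝ) z
    simpa [σ] using! h2
  have hδ : denom (δ : GL (Fin 2) ℝ) z ≠ 0 := denom_ne_zero _ z
  have hγ : denom (γ : GL (Fin 2) ℝ) (δ • z : ℍ) ≠ 0 := denom_ne_zero _ _
  have h3 : denom (γ : GL (Fin 2) ℝ) (δ • z : ℍ) * denom δ z =
      (γ 1 0 : ℂ) * (δ 0 0 * z + δ 0 1) + γ 1 1 * denom δ z := by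
    have e : ((δ • z : ℍ) : ℂ) = ((δ 0 0 : ℂ) * z + δ 0 1) / denom δ z := by
      rw [UpperHalfPlane.specialLinearGroup_apply]
      simp [ModularGroup.denom_apply]
    rw [ModularGroup.denom_apply, e]
    field_simp
  have hd : denom (δ : GL (Fin 2) ℝ) z = (δ 1 0 : ℂ) * z + δ 1 1 := ModularGroup.denom_apply _ _
  have hdet : (δ 0 0 : ℂ) * δ 1 1 - δ 0 1 * δ 1 0 = 1 := by
    have := Matrix.SpecialLinearGroup.det_coe δ
    rw [Matrix.det_fin_two] at this
    exact_mod_cast this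
  have hm : ((γ * δ) 1 0 : ℂ) = γ 1 0 * δ 0 0 + γ 1 1 * δ 1 0 := by
    simp [Matrix.mul_apply, Fin.sum_univ_two]
  simp only [ratio]
  rw [hm, h1]
  have h4 : (γ 1 0 : ℂ) * δ 0 0 + γ 1 1 * δ 1 0 =
      ((γ 1 0 : ℂ) + denom γ (δ • z : ℍ) * denom δ z * δ 1 0) / denom δ z := by
    rw [h3, eq_div_iff hδ, hd]
    linear_combination (γ 1 0 : ℂ) * hdet
  rw [h4]
  field_simp

/-- The lower unipotent matrices with corner entry `mN` already give pairwise distinct values. -/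
lemma infinite_ratio {N : ℕ} (hN : N ≠ 0) (z : ℍ) :
    {x : ℂ | ∃ γ ∈ Gamma N, ratio γ z = x}.Infinite := by
  let g : ℕ → SL(2, ℤ) := fun m => ⟨!![1, 0; (m * N : ℤ), 1], by simp [Matrix.det_fin_two]⟩
  have hg : ∀ m, g m ∈ Gamma N := fun m => by
    rw [Gamma_mem]; simp [g]
  have hr : ∀ m, ratio (g m) z = (m * N : ℂ) / ((m * N : ℂ) * z + 1) := fun m => by
    rw [ratio, ModularGroup.denom_apply]; simp [g]
  have hne : ∀ m : ℕ, (m * N : ℂ) * z + 1 ≠ 0 := fun m => by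
    have := denom_ne_zero (g m : GL (Fin 2) ℝ) z
    rw [ModularGroup.denom_apply] at this
    simpa [g] using this
  refine (Set.infinite_range_of_injective (f := fun m => ratio (g m) z) ?_).mono ?_
  · intro m n h
    dsimp only at h
    rw [hr, hr, div_eq_div_iff (hne m) (hne n)] at h
    have h2 : (m * N : ℂ) = n * N := by linear_combination h
    exact_mod_cast mul_right_cancel₀ (Nat.cast_ne_zero.mpr hN) h2
  · rintro _ ⟨m, rfl⟩
    exact ⟨g m, hg m, rfl⟩

lemma polynomial_eq_of_eval_ratio {N : ℕ} (hN : N ≠ 0) (z : ℍ) (P Q : Polynomial ℂ)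
    (h : ∀ γ ∈ Gamma N, P.eval (ratio γ z) = Q.eval (ratio γ z)) : P = Q := by
  refine Polynomial.eq_of_infinite_eval_eq P Q ((infinite_ratio hN z).mono ?_)
  rintro _ ⟨γ, hγ, rfl⟩
  exact h γ hγ

/-- Powers of `X - x` are monic, so recentering a polynomial does not affect its top coefficient. -/
lemma coeff_sum_pow_X_sub_C (s : ℕ) (a : ℕ → ℂ) (x : ℂ) :
    (∑ j ∈ Finset.range (s + 1),
      Polynomial.C (a j) * (Polynomial.X - Polynomial.C x) ^ j).coeff s = a s := by
  rw [Polynomial.finsetSum_coeff, Finset.sum_range_succ, Finset.sum_eq_zero, zero_add,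
    Polynomial.coeff_C_mul]
  · have h := (Polynomial.monic_X_sub_C x).pow s
    rw [Polynomial.Monic, Polynomial.leadingCoeff, Polynomial.natDegree_pow,
      Polynomial.natDegree_X_sub_C, mul_one] at h
    rw [h, mul_one]
  · intro j hj
    rw [Polynomial.coeff_C_mul, Polynomial.coeff_eq_zero_of_natDegree_lt, mul_zero]
    rw [Polynomial.natDegree_pow, Polynomial.natDegree_X_sub_C, mul_one]
    exact Finset.mem_range.mp hj

lemma slash_sub (k : ℤ) (γ : SL(2, ℤ)) (f g : ℍ → ℂ) :
    (f - g) ∣[k] γ = f ∣[k] γ - g ∣[k] γ := by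
  rw [sub_eq_add_neg, SlashAction.add_slash, SlashAction.neg_slash, ← sub_eq_add_neg]

/-- The top coefficient of a quasimodular form is slash invariant. -/
lemma slash_top_coeff {N k s : ℕ} (hN : N ≠ 0) {f : ℍ → ℂ} {F : ℕ → ℍ → ℂ}
    (hF : ∀ γ ∈ Gamma N, ∀ z : ℍ, (f ∣[(k : ℤ)] γ) z =
      ∑ j ∈ Finset.range (s + 1), F j z * ratio γ z ^ j)
    {δ : SL(2, ℤ)} (hδ : δ ∈ Gamma N) : F s ∣[(k : ℤ) - 2 * s] δ = F s := by
  ext z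
  have hd : denom (δ : GL (Fin 2) ℝ) z ≠ 0 := denom_ne_zero _ z
  -- Compute `(f|γ)(z)` directly, and also as `((f|γδ⁻¹)|δ)(z)`. By the cocycle rule the second is a
  -- polynomial in `ratio γ z - ratio δ z` with coefficients `Fⱼ|δ`. The right side is written with
  -- `X - C 0` so that one lemma reads off both top coefficients.
  have key := polynomial_eq_of_eval_ratio hN z
    (∑ j ∈ Finset.range (s + 1), Polynomial.C ((F j ∣[(k : ℤ) - 2 * j] δ) z) *
      (Polynomial.X - Polynomial.C (ratio δ z)) ^ j)
    (∑ j ∈ Finset.range (s + 1), Polynomial.C (F j z) *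
      (Polynomial.X - Polynomial.C 0) ^ j) ?_
  · have h := congrArg (fun P => Polynomial.coeff P s) key
    simpa only [coeff_sum_pow_X_sub_C] using h
  intro γ hγ
  have h1 := hF γ hγ z
  have h2 : (f ∣[(k : ℤ)] γ) z = (f ∣[(k : ℤ)] (γ * δ⁻¹)) (δ • z) * denom δ z ^ (-(k : ℤ)) := by
    rw [← ModularForm.SL_slash_apply, ← SlashAction.slash_mul, inv_mul_cancel_right]
  rw [hF _ (mul_mem hγ (inv_mem hδ)), h1] at h2
  have h3 := ratio_mul (γ * δ⁻¹) δ z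
  rw [inv_mul_cancel_right] at h3
  simp only [Polynomial.eval_finsetSum, Polynomial.eval_mul, Polynomial.eval_C,
    Polynomial.eval_pow, Polynomial.eval_sub, Polynomial.eval_X, sub_zero]
  rw [h2, Finset.sum_mul]
  refine Finset.sum_congr rfl fun j _ => ?_
  rw [h3, add_sub_cancel_right, ModularForm.SL_slash_apply, mul_pow, neg_sub, zpow_sub₀ hd,
    zpow_neg, zpow_mul, inv_pow]
  norm_cast
  field_simp

/-! ### Powers of `G₂` over modular forms -/

lemma G2_slash_apply (γ : SL(2, ℤ)) (z : ℍ) :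
    (G2 ∣[(2 : ℤ)] γ) z = G2 z + I / (4 * Real.pi) * ratio γ z := by
  have hpi : (Real.pi : ℂ) ≠ 0 := ofReal_ne_zero.mpr Real.pi_ne_zero
  rw [G2_eq, ModularForm.SL_smul_slash, Pi.smul_apply, E2_slash_apply, Pi.smul_apply,
    smul_eq_mul, smul_eq_mul, ratio]
  field_simp
  ring

lemma slash_mul_G2_pow (l : ℤ) (g : ℍ → ℂ) (i : ℕ) (γ : SL(2, ℤ)) :
    (g * G2 ^ i) ∣[l + 2 * i] γ = (g ∣[l] γ) * (G2 ∣[(2 : ℤ)] γ) ^ i := by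
  induction i with
  | zero => simp
  | succ i ih =>
    rw [pow_succ, ← mul_assoc, show l + 2 * ((i + 1 : ℕ) : ℤ) = (l + 2 * i) + 2 by push_cast; ring,
      ModularForm.mul_slash_SL2, ih, pow_succ, mul_assoc]

lemma I_div_four_pi_ne_zero : (I / (4 * Real.pi) : ℂ) ≠ 0 := by
  simp [Real.pi_ne_zero]

/-- Powers of `G₂` are linearly independent over modular forms. -/
lemma eq_zero_of_sum_mul_G2_pow {N k n : ℕ} (hN : N ≠ 0) {g : ℕ → ℍ → ℂ}
    (hg : ∀ i < n, ∀ γ ∈ Gamma N, g i ∣[(k : ℤ) - 2 * i] γ = g i)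
    (h : ∑ i ∈ Finset.range n, g i * G2 ^ i = 0) : ∀ i < n, g i = 0 := by
  intro i hi
  ext z
  have key : ∑ i ∈ Finset.range n, Polynomial.C (g i z) * Polynomial.X ^ i = 0 := by
    -- Slashing the relation by `γ` fixes each `g i` and moves `G₂(z)` along an affine line
    -- parametrized by `ratio γ z`. Composition with a nonconstant affine polynomial loses nothing.
    have hcomp : (∑ i ∈ Finset.range n, Polynomial.C (g i z) * Polynomial.X ^ i).comp
        (Polynomial.C (G2 z) + Polynomial.C (I / (4 * Real.pi)) * Polynomial.X) = 0 := by
      refine polynomial_eq_of_eval_ratio hN z _ _ fun γ hγ => ?_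
      have h1 := congrFun (congrArg (fun f => f ∣[(k : ℤ)] γ) h) z
      simp only [SlashAction.zero_slash, SlashAction.sum_slash, Finset.sum_apply,
        Pi.zero_apply] at h1
      simp only [Polynomial.eval_comp, Polynomial.eval_finsetSum, Polynomial.eval_mul,
        Polynomial.eval_C, Polynomial.eval_pow, Polynomial.eval_X, Polynomial.eval_add,
        Polynomial.eval_zero]
      rw [← h1]
      refine Finset.sum_congr rfl fun j hj => ?_
      have h2 := slash_mul_G2_pow ((k : ℤ) - 2 * j) (g j) j γ
      rw [sub_add_cancel, hg j (Finset.mem_range.mp hj) γ hγ] at h2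
      rw [h2, Pi.mul_apply, Pi.pow_apply, G2_slash_apply]
    rcases Polynomial.comp_eq_zero_iff.mp hcomp with h0 | ⟨-, h0⟩
    · exact h0
    · have := congrArg (fun P => Polynomial.coeff P 1) h0
      simp [Polynomial.coeff_C, Real.pi_ne_zero] at this
  have h3 := congrArg (fun P => Polynomial.coeff P i) key
  simpa [Polynomial.finsetSum_coeff, Polynomial.coeff_X_pow, hi] using h3

lemma IsModular.eq_zero_of_neg {N : ℕ} (hN : N ≠ 0) {k : ℤ} (hk : k < 0) {f : ℍ → ℂ}
    (hf : IsModular N k f) : f = 0 := by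
  have : NeZero N := ⟨hN⟩
  obtain ⟨g, rfl⟩ := (exists_modularForm_iff hN).mpr hf
  rw [ModularForm.isZero_of_neg_weight hk g]
  rfl

/-- Subtracting a multiple of `F (s + 1) * G₂ ^ (s + 1)` lowers the depth. -/
lemma IsQuasimodular.exists_sub {N k s : ℕ} (hN : N ≠ 0) {f : ℍ → ℂ}
    (hf : IsQuasimodular N k (s + 1) f) : ∃ g : ℍ → ℂ,
      IsModular N ((k : ℤ) - 2 * (s + 1 : ℕ)) g ∧
      IsQuasimodular N k s (f - g * G2 ^ (s + 1)) := by
  obtain ⟨h0, F, h1, h2, h3⟩ := hf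
  set c : ℂ := I / (4 * Real.pi) with hc
  have hc0 : c ≠ 0 := I_div_four_pi_ne_zero
  have htop : IsModular N ((k : ℤ) - 2 * (s + 1 : ℕ)) (F (s + 1)) :=
    ⟨fun δ hδ => slash_top_coeff hN h3 hδ, h1 _ le_rfl, h2 _ le_rfl⟩
  have hgm : IsModular N ((k : ℤ) - 2 * (s + 1 : ℕ)) ((c ^ (s + 1))⁻¹ • F (s + 1)) :=
    ⟨fun δ hδ => by rw [ModularForm.SL_smul_slash, htop.1 δ hδ], htop.2.1.const_smul _,
      fun δ => by
        rw [ModularForm.SL_smul_slash]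
        exact (htop.2.2 δ).const_smul_left _⟩
  set g := (c ^ (s + 1))⁻¹ • F (s + 1) with hg
  have hG : MDiff G2 := isQuasimodular_G2.1
  have hGp : ∀ i : ℕ, MDiff (G2 ^ i) := fun i => by
    induction i with
    | zero => exact mdifferentiable_const
    | succ i ih => rw [pow_succ]; exact ih.mul hG
  have hbp : ∀ (γ : SL(2, ℤ)) (i : ℕ), IsBoundedAtImInfty ((G2 ∣[(2 : ℤ)] γ) ^ i) := fun γ i => by
    induction i with
    | zero => exact Filter.const_boundedAtFilter _ 1
    | succ i ih => rw [pow_succ]; exact ih.mul (isBoundedAtImInfty_G2_slash γ)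
  -- The subtracted coefficients come from the binomial expansion of `(G₂ + c · ratio)^(s + 1)`. Its
  -- top coefficient is `c ^ (s + 1)`, which explains the normalization of `g`.
  refine ⟨g, hgm, h0.sub (hgm.2.1.mul (hGp _)),
    fun j => F j - (c ^ j * ((s + 1).choose j : ℂ)) • (g * G2 ^ (s + 1 - j)),
    fun j hj => (h1 j (by lia)).sub ((hgm.2.1.mul (hGp _)).const_smul _), fun j hj γ => ?_,
    fun γ hγ z => ?_⟩
  · have hb := h2 j (by lia) γ
    rw [slash_sub, ModularForm.SL_smul_slash]
    rw [show (k : ℤ) - 2 * j = ((k : ℤ) - 2 * (s + 1 : ℕ)) + 2 * (s + 1 - j : ℕ) by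
        push_cast [show j ≤ s + 1 by lia]; ring] at hb ⊢
    rw [slash_mul_G2_pow]
    exact hb.sub (((hgm.2.2 γ).mul (hbp γ _)).const_smul_left _)
  · have h4 := slash_mul_G2_pow ((k : ℤ) - 2 * (s + 1 : ℕ)) g (s + 1) γ
    rw [sub_add_cancel, hgm.1 γ hγ] at h4
    rw [slash_sub, Pi.sub_apply, h3 γ hγ z, h4, Pi.mul_apply, Pi.pow_apply,
      G2_slash_apply, ← hc, add_comm (G2 z), add_pow, Finset.mul_sum,
      ← Finset.sum_sub_distrib, Finset.sum_range_succ]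
    -- The term of degree `s + 1` cancels, so the remaining sum has depth at most `s`.
    have h5 : F (s + 1) z * ((γ 1 0 : ℂ) / denom γ z) ^ (s + 1) - g z *
        ((c * ratio γ z) ^ (s + 1) * G2 z ^ (s + 1 - (s + 1)) * ((s + 1).choose (s + 1) : ℂ)) = 0 := by
      rw [hg, Pi.smul_apply, smul_eq_mul, mul_pow, ratio]
      field_simp
      simp
    rw [h5, add_zero]
    refine Finset.sum_congr rfl fun j hj => ?_
    simp only [Pi.sub_apply, Pi.smul_apply, Pi.mul_apply, Pi.pow_apply, smul_eq_mul, ratio]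
    ring

/-! ### The structure theorem -/

lemma ofM_mul {i j : ℕ} (f : modTower i) (g : modTower j) :
    ofM i f * ofM j g = ofM (i + j) ⟨f * g, SetLike.GradedMul.mul_mem f.2 g.2⟩ := by
  exact DirectSum.of_mul_of (A := fun k => modTower k) f g

/-- Needed where two weights are equal but not definitionally so. -/
lemma ofM_congr {i j : ℕ} (h : i = j) (f : modTower i) (g : modTower j)
    (hfg : (f : ℍ → ℂ) = g) : ofM i f = ofM j g := by
  subst h
  rw [Subtype.ext hfg]

@[elab_as_elim]
lemma ModTower.induction {P : ModTower → Prop} (x : ModTower) (zero : P 0)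
    (of : ∀ k (f : modTower k), P (ofM k f)) (add : ∀ a b, P a → P b → P (a + b)) : P x :=
  DirectSum.induction_on (motive := P) x zero of add

@[elab_as_elim]
lemma QMTower.induction_of {P : QMTower → Prop} (x : QMTower) (zero : P 0)
    (of : ∀ k (f : qmTower k), P (ofQM k f)) (add : ∀ a b, P a → P b → P (a + b)) : P x :=
  DirectSum.induction_on (motive := P) x zero of add

/-- The component of weight `k`, as a function on the upper half plane. -/
def compM (k : ℕ) : ModTower →ₗ[ℂ] (ℍ → ℂ) where
  toFun x := (modTower k).subtype (DirectSum.component ℂ ℕ (fun k => modTower k) k x)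
  map_add' x y := LinearMap.map_add
    ((modTower k).subtype ∘ₗ DirectSum.component ℂ ℕ (fun k => modTower k) k) x y
  map_smul' c x := LinearMap.map_smul
    ((modTower k).subtype ∘ₗ DirectSum.component ℂ ℕ (fun k => modTower k) k) c x

lemma compM_mem (k : ℕ) (x : ModTower) : compM k x ∈ modTower k :=
  (DirectSum.component ℂ ℕ (fun k => modTower k) k x).2

lemma compM_of_same (k : ℕ) (f : modTower k) : compM k (ofM k f) = f :=
  congrArg Subtype.val (DirectSum.component.lof_self ℂ (M := fun k => modTower k) k f)

lemma compM_of_ne {k l : ℕ} (h : l ≠ k) (f : modTower l) : compM k (ofM l f) = 0 :=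
  congrArg Subtype.val (DirectSum.of_eq_of_ne (β := fun k => modTower k) l k f h.symm)

lemma eq_zero_of_compM {x : ModTower} (h : ∀ k, compM k x = 0) : x = 0 :=
  DirectSum.ext_component (M := fun k => modTower k) ℂ fun k => Subtype.ext (h k)

/-- The component of weight `k`, as a function on the upper half plane. -/
def compQM (k : ℕ) : QMTower →ₗ[ℂ] (ℍ → ℂ) where
  toFun x := (qmTower k).subtype (DirectSum.component ℂ ℕ (fun k => qmTower k) k x)
  map_add' x y := LinearMap.map_add
    ((qmTower k).subtype ∘ₗ DirectSum.component ℂ ℕ (fun k => qmTower k) k) x y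
  map_smul' c x := LinearMap.map_smul
    ((qmTower k).subtype ∘ₗ DirectSum.component ℂ ℕ (fun k => qmTower k) k) c x

lemma compQM_of_same (k : ℕ) (f : qmTower k) : compQM k (ofQM k f) = f :=
  congrArg Subtype.val (DirectSum.component.lof_self ℂ (M := fun k => qmTower k) k f)

lemma compQM_of_ne {k l : ℕ} (h : l ≠ k) (f : qmTower l) : compQM k (ofQM l f) = 0 :=
  congrArg Subtype.val (DirectSum.of_eq_of_ne (β := fun k => qmTower k) l k f h.symm)

lemma inclM_of (k : ℕ) (f : modTower k) :
    inclM (ofM k f) = ofQM k ⟨f, modTower_le_qmTower k f.2⟩ :=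
  liftM_of _ k f

lemma inclM_mul (a b : ModTower) : inclM (a * b) = inclM a * inclM b := by
  induction a using ModTower.induction with
  | zero => simp
  | add a a' ha ha' => rw [add_mul, map_add, map_add, add_mul, ha, ha']
  | of k f =>
    induction b using ModTower.induction with
    | zero => simp
    | add b b' hb hb' => rw [mul_add, map_add, map_add, mul_add, hb, hb']
    | of l g => rw [ofM_mul, inclM_of, inclM_of, inclM_of, ofQM_mul]

lemma mul_G2_pow_mem {k : ℕ} {f : ℍ → ℂ} (hf : f ∈ modTower k) (i : ℕ) :
    f * G2 ^ i ∈ qmTower (k + 2 * i) := by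
  induction i with
  | zero => simpa using modTower_le_qmTower k hf
  | succ i ih =>
    rw [pow_succ, ← mul_assoc]
    have h := SetLike.GradedMul.mul_mem (A := qmTower) ih G2_mem
    exact h

lemma inclM_of_mul_G2'_pow (k : ℕ) (f : modTower k) (i : ℕ) :
    inclM (ofM k f) * G2' ^ i = ofQM (k + 2 * i) ⟨f * G2 ^ i, mul_G2_pow_mem f.2 i⟩ := by
  induction i with
  | zero =>
    rw [pow_zero, mul_one, inclM_of]
    exact congrArg (ofQM k) (Subtype.ext (by simp))
  | succ i ih =>
    rw [pow_succ, ← mul_assoc, ih, G2', ofQM_mul]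
    exact congrArg (ofQM (k + 2 * i + 2)) (Subtype.ext (by simp [pow_succ, mul_assoc]))

/-- The case distinction guards against truncated subtraction: `G₂ⁱ` has weight `2i`, so nothing
appears in smaller weights. -/
lemma compQM_inclM_mul_G2'_pow (w i : ℕ) (a : ModTower) :
    compQM w (inclM a * G2' ^ i) = (if 2 * i ≤ w then compM (w - 2 * i) a else 0) * G2 ^ i := by
  induction a using ModTower.induction with
  | zero => simp
  | add a b ha hb =>
    rw [map_add, add_mul, map_add, ha, hb, ← add_mul, map_add]
    split_ifs <;> simp
  | of k f =>
    rw [inclM_of_mul_G2'_pow]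
    split_ifs with h
    · obtain ⟨l, rfl⟩ := Nat.exists_eq_add_of_le' h
      rw [Nat.add_sub_cancel]
      by_cases hkl : k = l
      · subst hkl
        rw [compQM_of_same, compM_of_same]
      · rw [compQM_of_ne (by lia), compM_of_ne hkl, zero_mul]
    · rw [compQM_of_ne (by lia), zero_mul]

lemma evalG2_single (i : ℕ) (a : ModTower) :
    evalG2 (Finsupp.single i a) = inclM a * G2' ^ i := by
  simp [evalG2]

lemma evalG2_eq_sum (p : ℕ →₀ ModTower) {n : ℕ} (hn : p.support ⊆ Finset.range n) :
    evalG2 p = ∑ i ∈ Finset.range n, inclM (p i) * G2' ^ i :=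
  Finsupp.sum_of_support_subset p hn _ (fun i _ => by simp)

/-- Independence of the powers of `G₂` is proved at a single level; finitely many forms share one,
the product of their levels. -/
lemma exists_common_level (w n : ℕ) (g : ℕ → ℍ → ℂ)
    (h : ∀ i < n, ∃ N : ℕ, N ≠ 0 ∧ IsModular N ((w : ℤ) - 2 * i) (g i)) :
    ∃ N : ℕ, N ≠ 0 ∧ ∀ i < n, IsModular N ((w : ℤ) - 2 * i) (g i) := by
  induction n with
  | zero => exact ⟨1, one_ne_zero, by simp⟩
  | succ n ih =>
    obtain ⟨N, hN, h1⟩ := ih fun i hi => h i (by lia)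
    obtain ⟨M, hM, h2⟩ := h n (by lia)
    refine ⟨N * M, mul_ne_zero hN hM, fun i hi => ?_⟩
    rcases Nat.lt_succ_iff_lt_or_eq.mp hi with hi | rfl
    · exact (h1 i hi).mono (Dvd.intro M rfl)
    · exact h2.mono (Dvd.intro_left N rfl)

lemma evalG2_injective : Function.Injective evalG2 := by
  rw [← LinearMap.ker_eq_bot, LinearMap.ker_eq_bot']
  intro p hp
  ext i
  refine eq_zero_of_compM fun k => ?_
  obtain ⟨m, hm⟩ := p.support.exists_nat_subset_range
  -- The bound must cover the support of `p` and also the index `i`, which may lie outside it.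
  set n := max m (i + 1) with hn
  rw [evalG2_eq_sum p (hm.trans (Finset.range_subset_range.mpr (le_max_left m (i + 1))))] at hp
  -- The total weight in which the weight `k` part of the `i`-th coefficient shows up.
  set w := k + 2 * i with hw
  have h := congrArg (compQM w) hp
  simp only [map_sum, compQM_inclM_mul_G2'_pow, map_zero] at h
  obtain ⟨N, hN, hmod⟩ := exists_common_level w n
    (fun i => if 2 * i ≤ w then compM (w - 2 * i) (p i) else 0) fun j _ => by
      split_ifs with hj
      · obtain ⟨N, hN, h⟩ := mem_modTower.mp (compM_mem (w - 2 * j) (p j))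
        refine ⟨N, hN, ?_⟩
        rwa [Nat.cast_sub hj, Nat.cast_mul, Nat.cast_ofNat] at h
      · refine ⟨1, one_ne_zero, fun γ _ => SlashAction.zero_slash _ _, mdifferentiable_const,
          fun γ => ?_⟩
        rw [SlashAction.zero_slash]
        exact Filter.const_boundedAtFilter _ 0
  have h2 := eq_zero_of_sum_mul_G2_pow hN (fun j hj => (hmod j hj).1) h i
    (lt_of_lt_of_le (Nat.lt_succ_self i) (le_max_right m (i + 1)))
  rwa [if_pos (by lia), show w - 2 * i = k by lia] at h2

/-- Induction on the depth: depth zero means modular, and otherwise `IsQuasimodular.exists_sub`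
splits off a modular multiple of `G₂ ^ (s + 1)`. -/
lemma ofQM_mem_range_evalG2 {N : ℕ} (hN : N ≠ 0) (s k : ℕ) (f : ℍ → ℂ)
    (hf : IsQuasimodular N k s f) (hm : f ∈ qmTower k) :
    ofQM k ⟨f, hm⟩ ∈ LinearMap.range evalG2 := by
  induction s generalizing f with
  | zero =>
    obtain ⟨h0, F, h1, h2, h3⟩ := hf
    have hfF : f = F 0 := by
      ext z
      simpa using h3 1 (one_mem _) z
    have hmod : f ∈ modTower k := mem_modTower.mpr ⟨N, hN, fun γ hγ => by
      have := slash_top_coeff hN h3 hγ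
      rw [← hfF] at this
      simpa using this, h0, fun γ => by
      have := h2 0 le_rfl γ
      rw [← hfF] at this
      simpa using this⟩
    exact ⟨Finsupp.single 0 (ofM k ⟨f, hmod⟩), by
      rw [evalG2_single, pow_zero, mul_one, inclM_of]⟩
  | succ s ih =>
    obtain ⟨g, hg, hsub⟩ := hf.exists_sub hN
    have h1 := ih _ hsub ⟨N, hN, s, hsub⟩
    by_cases hk : 2 * (s + 1) ≤ k
    · obtain ⟨l, rfl⟩ := Nat.exists_eq_add_of_le' hk
      have hgm : g ∈ modTower l := mem_modTower.mpr ⟨N, hN, by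
        simpa using hg⟩
      have h2 : evalG2 (Finsupp.single (s + 1) (ofM l ⟨g, hgm⟩)) =
          ofQM (l + 2 * (s + 1)) ⟨g * G2 ^ (s + 1), mul_G2_pow_mem hgm _⟩ := by
        rw [evalG2_single, inclM_of_mul_G2'_pow]
      have h3 := Submodule.add_mem _ h1 ⟨_, h2⟩
      rw [← map_add] at h3
      convert! h3 using 2
      exact Subtype.ext (sub_add_cancel f _).symm
    -- Here the split-off form has negative weight, hence vanishes, and `f` already has depth at
    -- most `s`.
    · have hg0 := hg.eq_zero_of_neg hN (by push_cast; lia)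
      convert! h1 using 2
      exact Subtype.ext (show f = f - g * G2 ^ (s + 1) by rw [hg0, zero_mul, sub_zero])

/-- The structure theorem for quasimodular forms, existence of the expansion. -/
lemma evalG2_surjective : Function.Surjective evalG2 := by
  intro x
  rw [← LinearMap.mem_range]
  induction x using QMTower.induction_of with
  | zero => exact zero_mem _
  | add a b ha hb => exact add_mem ha hb
  | of k f =>
    obtain ⟨f, N, hN, s, hf⟩ := f
    exact ofQM_mem_range_evalG2 hN s k f hf _

/-- Once `evalG2` is injective, its generalized inverse is a genuine left inverse. -/
lemma expansion_evalG2 (p : ℕ →₀ ModTower) : expansion (evalG2 p) = p :=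
  evalG2_injective (LinearMap.congr_fun (exists_generalized_inverse evalG2).choose_spec p)

@[elab_as_elim]
lemma QMTower.induction {P : QMTower → Prop} (x : QMTower) (zero : P 0)
    (mul_pow : ∀ a i, P (inclM a * G2' ^ i)) (add : ∀ a b, P a → P b → P (a + b)) : P x := by
  obtain ⟨p, rfl⟩ := evalG2_surjective x
  induction p using Finsupp.induction_linear with
  | zero => rwa [map_zero]
  | add p q hp hq => rw [map_add]; exact add _ _ hp hq
  | single i a => rw [evalG2_single]; exact mul_pow a i

/-! ### Operators on the quasimodular tower -/

lemma extendToQM_mul_pow (T : ModTower →ₗ[ℂ] ModTower) (a : ModTower) (i : ℕ) :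
    extendToQM T (inclM a * G2' ^ i) = inclM (T a) * G2' ^ i := by
  rw [← evalG2_single, ← evalG2_single, extendToQM, LinearMap.comp_apply, LinearMap.comp_apply,
    expansion_evalG2, Finsupp.mapRange.linearMap_apply, Finsupp.mapRange_single]

lemma extendToQM_comp (S T : ModTower →ₗ[ℂ] ModTower) (x : QMTower) :
    extendToQM S (extendToQM T x) = extendToQM (S ∘ₗ T) x := by
  induction x using QMTower.induction with
  | zero => simp
  | add a b ha hb => rw [map_add, map_add, map_add, ha, hb]
  | mul_pow a i => rw [extendToQM_mul_pow, extendToQM_mul_pow, extendToQM_mul_pow]; rfl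

lemma mul_pow_mul_mul_pow (a b : ModTower) (i j : ℕ) :
    inclM a * G2' ^ i * (inclM b * G2' ^ j) = inclM (a * b) * G2' ^ (i + j) := by
  rw [inclM_mul, pow_add]; ring

/-- The extension treats `G₂` as a constant, so an identity on products in `M` carries over monomial
by monomial. -/
lemma extendToQM_mul {T : ModTower →ₗ[ℂ] ModTower} (hT : ∀ a b, T (a * b) = T a * T b)
    (x y : QMTower) : extendToQM T (x * y) = extendToQM T x * extendToQM T y := by
  induction x using QMTower.induction with
  | zero => simp
  | add a b ha hb => rw [add_mul, map_add, map_add, add_mul, ha, hb]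
  | mul_pow a i =>
    induction y using QMTower.induction with
    | zero => simp
    | add b b' hb hb' => rw [mul_add, map_add, map_add, mul_add, hb, hb']
    | mul_pow b j =>
      rw [mul_pow_mul_mul_pow, extendToQM_mul_pow, extendToQM_mul_pow, extendToQM_mul_pow,
        mul_pow_mul_mul_pow, hT]

lemma extendToQM_leibniz {T : ModTower →ₗ[ℂ] ModTower}
    (hT : ∀ a b, T (a * b) = T a * b + a * T b) (x y : QMTower) :
    extendToQM T (x * y) = extendToQM T x * y + x * extendToQM T y := by
  induction x using QMTower.induction with
  | zero => simp
  | add a b ha hb => rw [add_mul, map_add, map_add, ha, hb]; ring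
  | mul_pow a i =>
    induction y using QMTower.induction with
    | zero => simp
    | add b b' hb hb' => rw [mul_add, map_add, map_add, hb, hb']; ring
    | mul_pow b j =>
      rw [mul_pow_mul_mul_pow, extendToQM_mul_pow, extendToQM_mul_pow, extendToQM_mul_pow,
        mul_pow_mul_mul_pow, mul_pow_mul_mul_pow, hT, map_add, add_mul]

/-! ### Slash by `SL₂(ℤ)`, `X` and `Y` on the modular tower, and their extensions -/

lemma slashFun_slToGL (k : ℕ) (γ : SL(2, ℤ)) (f : ℍ → ℂ) :
    slashFun k (slToGL γ) f = f ∣[(k : ℤ)] γ := by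
  have h : toReal (slToGL γ) = mapGL ℝ γ := by
    ext i j
    simp [toReal, slToGL]
  rw [slashFun_eq, h]
  have hdet : ((mapGL ℝ γ : GL (Fin 2) ℝ).det.val : ℂ) = 1 := by simp
  rw [hdet, one_zpow, inv_one, one_smul]
  rfl

lemma slashM_of (γ : SL(2, ℤ)) (k : ℕ) (f : modTower k) :
    slashM (slToGL γ) (ofM k f) =
      ofM k ⟨(f : ℍ → ℂ) ∣[(k : ℤ)] γ, slashFun_slToGL k γ f ▸ slashFun_mem _ f.2⟩ := by
  rw [slashM, liftM_of, LinearMap.comp_apply]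
  exact congrArg (ofM k) (Subtype.ext (slashFun_slToGL k γ f))

lemma XM_of (k : ℕ) (f : modTower k) : XM (ofM k f) = ofM (k + 2) ⟨XFun k f, XFun_mem f.2⟩ :=
  liftM_of _ k f

lemma YM_of (k : ℕ) (f : modTower k) : YM (ofM k f) = (k / 2 : ℂ) • ofM k f :=
  liftM_of _ k f

lemma slashM_comp (γ δ : SL(2, ℤ)) :
    slashM (slToGL δ) ∘ₗ slashM (slToGL γ) = slashM (slToGL (γ * δ)) := by
  ext x
  induction x using ModTower.induction with
  | zero => simp
  | add a b ha hb => rw [map_add, map_add, ha, hb]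
  | of k f =>
    rw [LinearMap.comp_apply, slashM_of, slashM_of, slashM_of]
    exact congrArg (ofM k) (Subtype.ext (SlashAction.slash_mul _ _ _ _).symm)

lemma slashM_mul (γ : SL(2, ℤ)) (a b : ModTower) :
    slashM (slToGL γ) (a * b) = slashM (slToGL γ) a * slashM (slToGL γ) b := by
  induction a using ModTower.induction with
  | zero => simp
  | add a b ha hb => rw [add_mul, map_add, map_add, add_mul, ha, hb]
  | of k f =>
    induction b using ModTower.induction with
    | zero => simp
    | add b b' hb hb' => rw [mul_add, map_add, map_add, mul_add, hb, hb']
    | of l g =>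
      rw [ofM_mul, slashM_of, slashM_of, slashM_of, ofM_mul]
      exact congrArg (ofM (k + l)) (Subtype.ext (by
        dsimp only
        rw [Nat.cast_add, ModularForm.mul_slash_SL2]))

lemma XM_mul (a b : ModTower) : XM (a * b) = XM a * b + a * XM b := by
  induction a using ModTower.induction with
  | zero => simp
  | add a b ha hb => rw [add_mul, map_add, map_add, ha, hb]; ring
  | of k f =>
    induction b using ModTower.induction with
    | zero => simp
    | add b b' hb hb' => rw [mul_add, map_add, map_add, hb, hb']; ring
    | of l g =>
      rw [ofM_mul, XM_of, XM_of, XM_of, ofM_mul, ofM_mul]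
      -- The weights `k + 2 + l` and `k + l + 2` must be identified before the two products can be
      -- added.
      have h1 : ∀ h : (XFun k f * g : ℍ → ℂ) ∈ modTower (k + 2 + l),
          ofM (k + 2 + l) ⟨XFun k f * g, h⟩ = ofM (k + l + 2)
            ⟨XFun k f * g, (show k + 2 + l = k + l + 2 by ring) ▸ h⟩ := fun h =>
        ofM_congr (by ring) _ _ rfl
      rw [h1]
      refine Eq.trans ?_ (map_add (ofM (k + l + 2)) _ _)
      refine congrArg (ofM (k + l + 2)) (Subtype.ext ?_)
      simp only [Submodule.coe_add, XFun_eq, Nat.cast_add]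
      exact Derivative.serreDerivative_mul _ _ _ _ (mdiff_of_mem f.2) (mdiff_of_mem g.2)

lemma YM_mul (a b : ModTower) : YM (a * b) = YM a * b + a * YM b := by
  induction a using ModTower.induction with
  | zero => simp
  | add a b ha hb => rw [add_mul, map_add, map_add, ha, hb]; ring
  | of k f =>
    induction b using ModTower.induction with
    | zero => simp
    | add b b' hb hb' => rw [mul_add, map_add, map_add, hb, hb']; ring
    | of l g =>
      rw [ofM_mul, YM_of, YM_of, YM_of, smul_mul_assoc, mul_smul_comm, ofM_mul, ← add_smul]
      congr 1
      push_cast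
      ring

/-- `X` is the Serre derivative: its `E₂` term cancels the failure of `d/dz` to commute with the
slash action. -/
lemma XM_comp_slashM (γ : SL(2, ℤ)) :
    XM ∘ₗ slashM (slToGL γ) = slashM (slToGL γ) ∘ₗ XM := by
  ext x
  induction x using ModTower.induction with
  | zero => simp
  | add a b ha hb => rw [map_add, map_add, ha, hb]
  | of k f =>
    rw [LinearMap.comp_apply, LinearMap.comp_apply, slashM_of, XM_of, XM_of, slashM_of]
    refine congrArg (ofM (k + 2)) (Subtype.ext ?_)
    simp only [XFun_eq]
    have := Derivative.serreDerivative_slash_equivariant (k := k) (mdiff_of_mem f.2) (γ := γ)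
    exact_mod_cast this.symm

lemma YM_comp_slashM (γ : SL(2, ℤ)) :
    YM ∘ₗ slashM (slToGL γ) = slashM (slToGL γ) ∘ₗ YM := by
  ext x
  induction x using ModTower.induction with
  | zero => simp
  | add a b ha hb => rw [map_add, map_add, ha, hb]
  | of k f =>
    rw [LinearMap.comp_apply, LinearMap.comp_apply, slashM_of, YM_of, YM_of, map_smul, slashM_of]

/-- `X` raises the weight by 2, hence the eigenvalue `k / 2` of `Y` by 1. -/
lemma YM_XM (x : ModTower) : YM (XM x) = XM (YM x) + XM x := by
  induction x using ModTower.induction with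
  | zero => simp
  | add a b ha hb => simp only [map_add, ha, hb]; abel
  | of k f =>
    rw [YM_of, map_smul, XM_of, YM_of]
    nth_rw 3 [← one_smul ℂ (ofM (k + 2) _)]
    rw [← add_smul]
    congr 1
    push_cast
    ring

lemma slashQM_mul (γ : SL(2, ℤ)) (x y : QMTower) :
    slashQM (slToGL γ) (x * y) = slashQM (slToGL γ) x * slashQM (slToGL γ) y :=
  extendToQM_mul (slashM_mul γ) x y

lemma slashQM_slashQM (γ δ : SL(2, ℤ)) (x : QMTower) :
    slashQM (slToGL δ) (slashQM (slToGL γ) x) = slashQM (slToGL (γ * δ)) x := by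
  rw [slashQM, slashQM, extendToQM_comp, slashM_comp, slashQM]

lemma XQM_slashQM (γ : SL(2, ℤ)) (x : QMTower) :
    XQM (slashQM (slToGL γ) x) = slashQM (slToGL γ) (XQM x) := by
  rw [XQM, slashQM, extendToQM_comp, extendToQM_comp, XM_comp_slashM]

lemma YQM_slashQM (γ : SL(2, ℤ)) (x : QMTower) :
    YQM (slashQM (slToGL γ) x) = slashQM (slToGL γ) (YQM x) := by
  rw [YQM, slashQM, extendToQM_comp, extendToQM_comp, YM_comp_slashM]

lemma XQM_mul (x y : QMTower) : XQM (x * y) = XQM x * y + x * XQM y :=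
  extendToQM_leibniz XM_mul x y

lemma YQM_mul (x y : QMTower) : YQM (x * y) = YQM x * y + x * YQM y :=
  extendToQM_leibniz YM_mul x y

lemma YQM_XQM (x : QMTower) : YQM (XQM x) = XQM (YQM x) + XQM x := by
  induction x using QMTower.induction with
  | zero => simp
  | add a b ha hb => simp only [map_add, ha, hb]; abel
  | mul_pow a i =>
    simp only [XQM, YQM, extendToQM_mul_pow]
    rw [YM_XM, map_add, add_mul]

/-! ### The pairing -/

variable {N : ℕ} {σ : SL(2, ℤ)}

lemma coset_eq_iff {α β : GL(2, ℚ)⁺} :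
    coset N α = coset N β ↔ β * α⁻¹ ∈ (Gamma N).map slToGL := by
  rw [coset, coset, Quotient.eq, QuotientGroup.rightRel_apply]

lemma coset_mul_right {α β : GL(2, ℚ)⁺} (h : coset N α = coset N β) (δ : GL(2, ℚ)⁺) :
    coset N (α * δ) = coset N (β * δ) := by
  rw [coset_eq_iff] at h ⊢
  simpa [mul_assoc] using h

lemma coset_slToGL_mul {γ : SL(2, ℤ)} (hγ : γ ∈ Gamma N) (α : GL(2, ℚ)⁺) :
    coset N (slToGL γ * α) = coset N α := by
  rw [coset_eq_iff, mul_inv_rev, mul_inv_cancel_left, ← map_inv]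
  exact ⟨γ⁻¹, inv_mem hγ, rfl⟩

lemma coset_out (x : Cosets N) : coset N x.out = x := Quotient.out_eq x

lemma valueAt_congr (F : Qtw N σ) {α β : GL(2, ℚ)⁺} (h : coset N α = coset N β) :
    valueAt F α = valueAt F β :=
  congrArg (F : Cosets N → QMTower) h

lemma valueAt_mul (F : Qtw N σ) (α : GL(2, ℚ)⁺) {γ : SL(2, ℤ)} (hγ : γ ∈ Gamma N) :
    valueAt F (α * slToGL γ) = slashQM (slToGL (σ * γ * σ⁻¹)) (valueAt F α) :=
  F.2.2 γ hγ α

lemma valueAt_add (F G : Qtw N σ) (α : GL(2, ℚ)⁺) :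
    valueAt (F + G) α = valueAt F α + valueAt G α := rfl

lemma valueAt_smul (c : ℂ) (F : Qtw N σ) (α : GL(2, ℚ)⁺) :
    valueAt (c • F) α = c • valueAt F α := rfl

lemma Qtw_ext {F G : Qtw N σ} (h : ∀ α, valueAt F α = valueAt G α) : F = G :=
  Subtype.ext (funext fun x => Quotient.inductionOn x h)

/-- The summand of the pairing attached to `β`. -/
def pairTerm (F₁ F₂ : Qtw N σ) (α : GL(2, ℚ)⁺) (β : SL(2, ℤ)) : QMTower :=
  valueAt F₁ (slToGL (β * σ)) *
    slashQM (slToGL (σ * β)) (valueAt F₂ (α * slToGL (σ⁻¹ * β⁻¹)))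

/-- The first factor sees only a coset. In the second, equivariance produces `‖σγ⁻¹σ⁻¹`, which
composes with `‖σγβ` to `‖σβ`. -/
lemma pairTerm_mul_left (F₁ F₂ : Qtw N σ) (α : GL(2, ℚ)⁺) {γ : SL(2, ℤ)} (hγ : γ ∈ Gamma N)
    (β : SL(2, ℤ)) : pairTerm F₁ F₂ α (γ * β) = pairTerm F₁ F₂ α β := by
  have h1 : valueAt F₁ (slToGL (γ * β * σ)) = valueAt F₁ (slToGL (β * σ)) := by
    rw [mul_assoc, map_mul]
    exact valueAt_congr F₁ (coset_slToGL_mul hγ _)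
  have h2 : valueAt F₂ (α * slToGL (σ⁻¹ * (γ * β)⁻¹)) =
      slashQM (slToGL (σ * γ⁻¹ * σ⁻¹)) (valueAt F₂ (α * slToGL (σ⁻¹ * β⁻¹))) := by
    rw [← valueAt_mul F₂ _ (inv_mem hγ), mul_assoc, ← map_mul, mul_inv_rev, mul_assoc]
  rw [pairTerm, h1, h2, slashQM_slashQM, pairTerm]
  congr 4
  group

lemma pairTerm_congr_left (F₁ F₂ : Qtw N σ) {α α' : GL(2, ℚ)⁺} (h : coset N α = coset N α')
    (β : SL(2, ℤ)) : pairTerm F₁ F₂ α β = pairTerm F₁ F₂ α' β := by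
  rw [pairTerm, pairTerm, valueAt_congr F₂ (coset_mul_right h _)]

lemma pairTerm_congr_right (F₁ F₂ : Qtw N σ) (α : GL(2, ℚ)⁺) {β β' : SL(2, ℤ)}
    (h : (Quotient.mk _ β : SLCosets N) = Quotient.mk _ β') :
    pairTerm F₁ F₂ α β = pairTerm F₁ F₂ α β' := by
  rw [Quotient.eq, QuotientGroup.rightRel_apply] at h
  rw [← pairTerm_mul_left F₁ F₂ α h β, inv_mul_cancel_right]

/-- The shift of `β` is chosen so that the argument of `F₂` does not change while that of `F₁`
becomes `βσγ`, where equivariance applies. -/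
lemma pairTerm_mul_right (F₁ F₂ : Qtw N σ) (α : GL(2, ℚ)⁺) {γ : SL(2, ℤ)} (hγ : γ ∈ Gamma N)
    (β : SL(2, ℤ)) : pairTerm F₁ F₂ (α * slToGL γ) (β * (σ * γ * σ⁻¹)) =
      slashQM (slToGL (σ * γ * σ⁻¹)) (pairTerm F₁ F₂ α β) := by
  have h1 : β * (σ * γ * σ⁻¹) * σ = β * σ * γ := by group
  have h2 : γ * (σ⁻¹ * (β * (σ * γ * σ⁻¹))⁻¹) = σ⁻¹ * β⁻¹ := by group
  rw [pairTerm, pairTerm, slashQM_mul, slashQM_slashQM, ← valueAt_mul F₁ _ hγ, ← map_mul,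
    mul_assoc α, ← map_mul, h1, h2, mul_assoc σ β]

lemma pairingFormula_eq (r : SLCosets N → SL(2, ℤ)) (F₁ F₂ : Qtw N σ) (α : GL(2, ℚ)⁺) :
    pairingFormula r F₁ F₂ α = ∑ᶠ q, pairTerm F₁ F₂ α (r q) := rfl

lemma pairingFormula_congr {r r' : SLCosets N → SL(2, ℤ)} (hr : ∀ q, Quotient.mk _ (r q) = q)
    (hr' : ∀ q, Quotient.mk _ (r' q) = q) (F₁ F₂ : Qtw N σ) {α α' : GL(2, ℚ)⁺}
    (h : coset N α = coset N α') : pairingFormula r F₁ F₂ α = pairingFormula r' F₁ F₂ α' :=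
  finsum_congr fun q => (pairTerm_congr_left F₁ F₂ h _).trans
    (pairTerm_congr_right F₁ F₂ α' ((hr q).trans (hr' q).symm))

/-- Finiteness ensures that every `finsum` over the cosets is a true sum, not the default value 0.
-/
lemma finite_SLCosets (hN : 1 ≤ N) : Finite (SLCosets N) := by
  have : NeZero N := ⟨by lia⟩
  exact Finite.of_equiv _ (QuotientGroup.quotientRightRelEquivQuotientLeftRel (Gamma N)).symm

/-- Right translation on `Γ(N) \ SL₂(ℤ)`. -/
def mulRightSLCosets (δ : SL(2, ℤ)) : SLCosets N ≃ SLCosets N where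
  toFun := Quotient.map (· * δ) fun a b h => by
    change QuotientGroup.rightRel _ _ _
    rw [QuotientGroup.rightRel_apply]
    have h' := QuotientGroup.rightRel_apply.mp h
    simpa [mul_assoc] using h'
  invFun := Quotient.map (· * δ⁻¹) fun a b h => by
    change QuotientGroup.rightRel _ _ _
    rw [QuotientGroup.rightRel_apply]
    have h' := QuotientGroup.rightRel_apply.mp h
    simpa [mul_assoc] using h'
  left_inv q := Quotient.inductionOn q fun a => by simp
  right_inv q := Quotient.inductionOn q fun a => by simp

lemma mulRightSLCosets_mk (δ β : SL(2, ℤ)) :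
    mulRightSLCosets δ (Quotient.mk _ β : SLCosets N) = Quotient.mk _ (β * δ) := rfl

/-- Right translation by `σγσ⁻¹` permutes the cosets, and `pairTerm_mul_right` matches the summands.
-/
lemma pairingFormula_mul (hN : 1 ≤ N) (F₁ F₂ : Qtw N σ) (α : GL(2, ℚ)⁺) {γ : SL(2, ℤ)}
    (hγ : γ ∈ Gamma N) : pairingFormula Quotient.out F₁ F₂ (α * slToGL γ) =
      slashQM (slToGL (σ * γ * σ⁻¹)) (pairingFormula Quotient.out F₁ F₂ α) := by
  have := finite_SLCosets hN
  rw [pairingFormula_eq, pairingFormula_eq, map_finsum _ (Set.toFinite _),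
    ← finsum_comp_equiv (mulRightSLCosets (σ * γ * σ⁻¹))]
  refine finsum_congr fun q => ?_
  rw [← pairTerm_mul_right F₁ F₂ α hγ]
  refine pairTerm_congr_right F₁ F₂ _ ?_
  rw [Quotient.out_eq, ← mulRightSLCosets_mk, Quotient.out_eq]

/-- The pairing, as a function on cosets. -/
def pairFun (F₁ F₂ : Qtw N σ) (x : Cosets N) : QMTower :=
  pairingFormula Quotient.out F₁ F₂ x.out

lemma pairFun_coset (F₁ F₂ : Qtw N σ) (α : GL(2, ℚ)⁺) :
    pairFun F₁ F₂ (coset N α) = pairingFormula Quotient.out F₁ F₂ α :=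
  pairingFormula_congr Quotient.out_eq Quotient.out_eq F₁ F₂ (coset_out _)

lemma finite_support_pairFun (hN : 1 ≤ N) (F₁ F₂ : Qtw N σ) :
    (pairFun F₁ F₂).support.Finite := by
  have := finite_SLCosets hN
  let h : SLCosets N → GL(2, ℚ)⁺ := fun q => slToGL (σ⁻¹ * q.out⁻¹)
  -- A nonzero value at `x` forces `F₂` to be nonzero at `x · h q` for some `q`, so the support lies
  -- in finitely many right translates of the support of `F₂`.
  refine (Set.finite_iUnion fun q : SLCosets N =>
    F₂.2.1.image fun y : Cosets N => coset N (y.out * (h q)⁻¹)).subset fun x hx => ?_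
  rw [Function.mem_support, pairFun, pairingFormula_eq] at hx
  obtain ⟨q, hq⟩ : ∃ q : SLCosets N, pairTerm F₁ F₂ x.out q.out ≠ 0 := by
    by_contra! h0
    exact hx ((finsum_congr h0).trans finsum_zero)
  refine Set.mem_iUnion.mpr ⟨q, coset N (x.out * h q), fun h0 => hq ?_, ?_⟩
  · have h1 : valueAt F₂ (x.out * slToGL (σ⁻¹ * q.out⁻¹)) = 0 := h0
    rw [pairTerm, h1, map_zero, mul_zero]
  · dsimp only
    rw [coset_mul_right (coset_out (coset N (x.out * h q))), mul_inv_cancel_right, coset_out]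

/-- The pairing on `Q_σ(Γ(N))`. -/
def pairing (hN : 1 ≤ N) : Qtw N σ →ₗ[ℂ] Qtw N σ →ₗ[ℂ] Qtw N σ :=
  have := finite_SLCosets hN
  LinearMap.mk₂ ℂ
    (fun F₁ F₂ => ⟨pairFun F₁ F₂, finite_support_pairFun hN F₁ F₂, fun γ hγ α => by
      rw [pairFun_coset, pairFun_coset, pairingFormula_mul hN F₁ F₂ α hγ]⟩)
    (fun F F' G => Subtype.ext <| funext fun x => by
      refine Eq.trans ?_ (finsum_add_distrib (Set.toFinite _) (Set.toFinite _))
      exact finsum_congr fun q => by simp only [valueAt_add, add_mul])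
    (fun c F G => Subtype.ext <| funext fun x => by
      refine Eq.trans ?_ (smul_finsum' c (Set.toFinite _)).symm
      exact finsum_congr fun q => by simp only [valueAt_smul, smul_mul_assoc])
    (fun F G G' => Subtype.ext <| funext fun x => by
      refine Eq.trans ?_ (finsum_add_distrib (Set.toFinite _) (Set.toFinite _))
      exact finsum_congr fun q => by simp only [valueAt_add, map_add, mul_add])
    (fun c F G => Subtype.ext <| funext fun x => by
      refine Eq.trans ?_ (smul_finsum' c (Set.toFinite _)).symm
      exact finsum_congr fun q => by simp only [valueAt_smul, map_smul, mul_smul_comm])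

lemma valueAt_pairing (hN : 1 ≤ N) (F₁ F₂ : Qtw N σ) (α : GL(2, ℚ)⁺) :
    valueAt (pairing hN F₁ F₂) α = pairingFormula Quotient.out F₁ F₂ α :=
  pairFun_coset F₁ F₂ α

/-! ### The action of `l₁` and `h₁` -/

/-- The operator on `Q_σ(Γ(N))` given by an operator on `QM` commuting with `SL₂(ℤ)`. -/
def mapQtw (D : QMTower →ₗ[ℂ] QMTower)
    (hD : ∀ γ x, D (slashQM (slToGL γ) x) = slashQM (slToGL γ) (D x)) :
    Module.End ℂ (Qtw N σ) where
  toFun F := ⟨fun x => D ((F : Cosets N → QMTower) x),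
    F.2.1.subset fun x hx h0 => hx (by
      change D ((F : Cosets N → QMTower) x) = 0
      rw [h0, map_zero]),
    fun γ hγ α => by
      dsimp only
      rw [F.2.2 γ hγ α, hD]⟩
  map_add' F G := Subtype.ext <| funext fun _ => map_add D _ _
  map_smul' c F := Subtype.ext <| funext fun _ => map_smul D c _

lemma valueAt_mapQtw (D : QMTower →ₗ[ℂ] QMTower)
    (hD : ∀ γ x, D (slashQM (slToGL γ) x) = slashQM (slToGL γ) (D x)) (F : Qtw N σ)
    (α : GL(2, ℚ)⁺) : valueAt (mapQtw D hD F) α = D (valueAt F α) := rfl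

lemma mapQtw_pairing (hN : 1 ≤ N) (D : QMTower →ₗ[ℂ] QMTower)
    (hD : ∀ γ x, D (slashQM (slToGL γ) x) = slashQM (slToGL γ) (D x))
    (hmul : ∀ x y, D (x * y) = D x * y + x * D y) (F₁ F₂ : Qtw N σ) :
    mapQtw D hD (pairing hN F₁ F₂) =
      pairing hN (mapQtw D hD F₁) F₂ + pairing hN F₁ (mapQtw D hD F₂) := by
  have := finite_SLCosets hN
  refine Qtw_ext fun α => ?_
  rw [valueAt_add, valueAt_mapQtw, valueAt_pairing, valueAt_pairing, valueAt_pairing,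
    pairingFormula_eq, pairingFormula_eq, pairingFormula_eq, map_finsum _ (Set.toFinite _),
    ← finsum_add_distrib (Set.toFinite _) (Set.toFinite _)]
  refine finsum_congr fun q => ?_
  rw [pairTerm, pairTerm, pairTerm, hmul, hD, valueAt_mapQtw, valueAt_mapQtw]

/-- The operator `X` on `Q_σ(Γ(N))`. -/
def XQ : Module.End ℂ (Qtw N σ) := mapQtw XQM XQM_slashQM

/-- The operator `Y` on `Q_σ(Γ(N))`. -/
def YQ : Module.End ℂ (Qtw N σ) := mapQtw YQM YQM_slashQM

lemma YQ_mul_XQ : (YQ : Module.End ℂ (Qtw N σ)) * XQ = XQ * YQ + XQ :=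
  LinearMap.ext fun F => Qtw_ext fun α => YQM_XQM (valueAt F α)

/-- The Lie action of `l₁` on `Q_σ(Γ(N))`. -/
def lieAction : L1 →ₗ⁅ℂ⁆ Module.End ℂ (Qtw N σ) where
  toFun u := u.1 • XQ + u.2 • YQ
  map_add' u v := by rw [L1.add_fst, L1.add_snd, add_smul, add_smul]; abel
  map_smul' c u := by
    rw [L1.smul_fst, L1.smul_snd, mul_smul, mul_smul, RingHom.id_apply, smul_add]
  map_lie' {u v} := by
    rw [L1.lie_fst, L1.lie_snd, LieRing.of_associative_ring_bracket]
    simp only [mul_add, add_mul, smul_mul_smul_comm, YQ_mul_XQ]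
    module

lemma lieAction_apply (u : L1) :
    (lieAction u : Module.End ℂ (Qtw N σ)) = u.1 • XQ + u.2 • YQ := rfl

lemma lieAction_X : (lieAction L1.X : Module.End ℂ (Qtw N σ)) = XQ := by
  rw [lieAction_apply]
  change (1 : ℂ) • XQ + (0 : ℂ) • YQ = XQ
  rw [one_smul, zero_smul, add_zero]

lemma lieAction_Y : (lieAction L1.Y : Module.End ℂ (Qtw N σ)) = YQ := by
  rw [lieAction_apply]
  change (0 : ℂ) • XQ + (1 : ℂ) • YQ = YQ
  rw [one_smul, zero_smul, zero_add]

lemma lieAction_pairing (hN : 1 ≤ N) (u : L1) (F₁ F₂ : Qtw N σ) :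
    lieAction u (pairing hN F₁ F₂) =
      pairing hN (lieAction u F₁) F₂ + pairing hN F₁ (lieAction u F₂) := by
  simp only [lieAction_apply, LinearMap.add_apply, LinearMap.smul_apply, map_add, map_smul,
    XQ, YQ, mapQtw_pairing hN _ _ XQM_mul,
    mapQtw_pairing hN _ _ YQM_mul]
  module

/-! ### The enveloping algebra and the coproduct formula -/

-- The elements with property `P` form a subalgebra containing the image of `l₁`. The universal
-- property retracts `h₁` into it, and by uniqueness the composite with the inclusion is the
-- identity.
@[elab_as_elim]
lemma H1.induction {P : H1 → Prop} (h : H1)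
    (algebraMap : ∀ c, P (algebraMap ℂ H1 c))
    (ι : ∀ u, P (UniversalEnvelopingAlgebra.ι ℂ u))
    (mul : ∀ a b, P a → P b → P (a * b)) (add : ∀ a b, P a → P b → P (a + b)) : P h := by
  let S : Subalgebra ℂ H1 :=
    { carrier := {a | P a}
      mul_mem' := fun {a b} => mul a b
      add_mem' := fun {a b} => add a b
      algebraMap_mem' := algebraMap }
  let f : L1 →ₗ⁅ℂ⁆ S :=
    { toFun := fun u => ⟨UniversalEnvelopingAlgebra.ι ℂ u, ι u⟩
      map_add' := fun u v => Subtype.ext (map_add _ _ _)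
      map_smul' := fun c u => Subtype.ext (map_smul _ _ _)
      map_lie' := fun {u v} => Subtype.ext
        (LieHom.map_lie (UniversalEnvelopingAlgebra.ι ℂ) u v) }
  have hid : S.val.comp (UniversalEnvelopingAlgebra.lift ℂ f) = AlgHom.id ℂ H1 := by
    refine UniversalEnvelopingAlgebra.hom_ext ℂ (LieHom.ext fun u => ?_)
    change ((UniversalEnvelopingAlgebra.lift ℂ f (UniversalEnvelopingAlgebra.ι ℂ u) : S) : H1) =
      UniversalEnvelopingAlgebra.ι ℂ u
    rw [UniversalEnvelopingAlgebra.lift_ι_apply]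
    rfl
  have h1 : ((UniversalEnvelopingAlgebra.lift ℂ f h : S) : H1) = h :=
    DFunLike.congr_fun hid h
  exact h1 ▸ (UniversalEnvelopingAlgebra.lift ℂ f h).2

lemma coproduct_ι (u : L1) : coproduct (UniversalEnvelopingAlgebra.ι ℂ u) =
    UniversalEnvelopingAlgebra.ι ℂ u ⊗ₜ[ℂ] (1 : H1) +
      (1 : H1) ⊗ₜ[ℂ] UniversalEnvelopingAlgebra.ι ℂ u := by
  rw [coproduct, UniversalEnvelopingAlgebra.lift_ι_apply]
  rfl

section Coproduct

variable {V : Type*} [AddCommGroup V] [Module ℂ V]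

/-- The action of `h₁ ⊗ h₁` on `V ⊗ V` induced by an action of `h₁` on `V`. -/
def tensorAction (A : H1 →ₐ[ℂ] Module.End ℂ V) :
    H1 ⊗[ℂ] H1 →ₐ[ℂ] Module.End ℂ (V ⊗[ℂ] V) :=
  Module.endTensorEndAlgHom.comp (Algebra.TensorProduct.map A A)

lemma tensorAction_tmul (A : H1 →ₐ[ℂ] Module.End ℂ V) (a b : H1) (v w : V) :
    tensorAction A (a ⊗ₜ b) (v ⊗ₜ w) = A a v ⊗ₜ A b w := rfl

/-- Passes from the algebra map `tensorAction`, convenient for induction, to the Sweedler form of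
the theorem. -/
lemma tensorAction_apply_tmul (A : H1 →ₐ[ℂ] Module.End ℂ V) (t : H1 ⊗[ℂ] H1) (v w : V) :
    tensorAction A t (v ⊗ₜ w) =
      TensorProduct.map (A.toLinearMap.flip v) (A.toLinearMap.flip w) t := by
  induction t using TensorProduct.induction_on with
  | zero => simp
  | tmul a b => rfl
  | add x y hx hy => rw [map_add, LinearMap.add_apply, hx, hy, map_add]

/-- If `l₁` acts by derivations of a bilinear product, then `h₁` acts compatibly with its
coproduct. -/
lemma lift_apply_eq_coproduct (ρ : L1 →ₗ⁅ℂ⁆ Module.End ℂ V) (p : V →ₗ[ℂ] V →ₗ[ℂ] V)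
    (hp : ∀ u v w, ρ u (p v w) = p (ρ u v) w + p v (ρ u w)) (h : H1) :
    UniversalEnvelopingAlgebra.lift ℂ ρ h ∘ₗ TensorProduct.lift p =
      TensorProduct.lift p ∘ₗ
        tensorAction (UniversalEnvelopingAlgebra.lift ℂ ρ) (coproduct h) := by
  -- The identity is one of linear maps on `V ⊗ V`: in the product case it is applied after a
  -- coproduct has acted, where tensors are no longer pure.
  induction h using H1.induction with
  | algebraMap c =>
    rw [AlgHom.commutes, AlgHom.commutes, AlgHom.commutes]
    ext v w
    simp [Module.algebraMap_end_apply]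
  | ι u =>
    refine TensorProduct.ext' fun v w => ?_
    rw [coproduct_ι, map_add, LinearMap.comp_apply, LinearMap.comp_apply, LinearMap.add_apply,
      tensorAction_tmul, tensorAction_tmul, UniversalEnvelopingAlgebra.lift_ι_apply, map_one,
      map_add, TensorProduct.lift.tmul, TensorProduct.lift.tmul, TensorProduct.lift.tmul, hp]
    rfl
  | mul a b ha hb =>
    rw [map_mul, map_mul, map_mul, Module.End.mul_eq_comp, Module.End.mul_eq_comp,
      LinearMap.comp_assoc, hb, ← LinearMap.comp_assoc, ha, LinearMap.comp_assoc]
  | add a b ha hb =>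
    rw [map_add, map_add, map_add, LinearMap.add_comp, LinearMap.comp_add, ha, hb]

end Coproduct

end QMHecke

end

/-- Independence of representatives is expressed by letting `r` range over all sections of the coset
map. The Sweedler sum is the image of the coproduct under `a ⊗ b ↦ (a F₁, b F₂)`. -/
theorem mainTheorem8 (N : ℕ) (hN : 1 ≤ N) (σ : SL(2, ℤ)) :
    ∃ pair : QMHecke.Qtw N σ →ₗ[ℂ] QMHecke.Qtw N σ →ₗ[ℂ] QMHecke.Qtw N σ,
      (∀ r : QMHecke.SLCosets N → SL(2, ℤ), (∀ q, Quotient.mk _ (r q) = q) →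
        ∀ (F₁ F₂ : QMHecke.Qtw N σ) (α : GL(2, ℚ)⁺),
          QMHecke.valueAt (pair F₁ F₂) α = QMHecke.pairingFormula r F₁ F₂ α) ∧
      ∃ ρ : QMHecke.L1 →ₗ⁅ℂ⁆ Module.End ℂ (QMHecke.Qtw N σ),
        (∀ (F : QMHecke.Qtw N σ) (α : GL(2, ℚ)⁺),
          QMHecke.valueAt (ρ QMHecke.L1.X F) α = QMHecke.XQM (QMHecke.valueAt F α) ∧
          QMHecke.valueAt (ρ QMHecke.L1.Y F) α = QMHecke.YQM (QMHecke.valueAt F α)) ∧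
        ∀ (h : QMHecke.H1) (F₁ F₂ : QMHecke.Qtw N σ),
          UniversalEnvelopingAlgebra.lift ℂ ρ h (pair F₁ F₂) =
            TensorProduct.lift pair
              (TensorProduct.map
                ((UniversalEnvelopingAlgebra.lift ℂ ρ).toLinearMap.flip F₁)
                ((UniversalEnvelopingAlgebra.lift ℂ ρ).toLinearMap.flip F₂)
                (QMHecke.coproduct h)) := by
  refine ⟨QMHecke.pairing hN, fun r hr F₁ F₂ α => ?_, QMHecke.lieAction, fun F α => ?_,
    fun h F₁ F₂ => ?_⟩
  · rw [QMHecke.valueAt_pairing]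
    exact QMHecke.pairingFormula_congr Quotient.out_eq hr F₁ F₂ rfl
  · rw [QMHecke.lieAction_X, QMHecke.lieAction_Y]
    exact ⟨rfl, rfl⟩
  · have key := LinearMap.congr_fun (QMHecke.lift_apply_eq_coproduct QMHecke.lieAction
      (QMHecke.pairing hN) (QMHecke.lieAction_pairing hN) h) (F₁ ⊗ₜ F₂)
    rw [LinearMap.comp_apply, LinearMap.comp_apply, TensorProduct.lift.tmul,
      QMHecke.tensorAction_apply_tmul] at key
    exact key
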